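/- Let $K$ be a field and $Q=(Q_0,Q_1,s,t)$ a finite quiver. Let $R(Q)$ be the representation ring of $Q$ over $K$: the free abelian group on isomorphism classes $[V]$ of finite-dimensional representations of $Q$, modulo the relations $[V\oplus W]=[V]+[W]$, with product $[V][W]=[V\otimes W]$ induced by the pointwise tensor product. A quiver over $Q$ is a pair $(Q',f')$ with $Q'$ a finite quiver and $f'\colon Q'\to Q$ a morphism of quivers; a morphism of quivers over $Q$ is a morphism of quivers commuting with the structure maps to $Q$. The linearization $L(Q',f')$ is the representation of $Q$ with space $\bigoplus_{y\in Q'_0,\ f'(y)=x}K e_y$ at the vertex $x$, in which an arrow $\alpha\colon x\to x'$ acts by $e_y\mapsto\sum_{\beta} e_{t(\beta)}$, the sum over all $\beta\in Q'_1$ with $f'(\beta)=\alpha$ and $s(\beta)=y$. Let $\mathscr C$ be a full subcategory of the category of quivers over $Q$ such that: - for each object $x$ of $\mathscr C$ there are only finitely many objects $z$ of $\mathscr C$ having a morphism $z\to x$ (for example, $\mathscr C$ has finitely many objects); - $\mathscr C$ is acyclic: its only endomorphisms are identities, and its only invertible morphisms are identities; - each object $(Q',f')$ of $\mathscr C$ is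 connected (and non-empty), and $f'$ is a wrapping, that is, for all $i,j\in Q'_0$ it is injective on the set of arrows from $i$ to $j$; - $\mathscr C$ is closed under fiber products: the fiber product over $Q$ of any two objects of $\mathscr C$ is isomorphic over $Q$ to a finite (possibly empty) disjoint union of objects of $\mathscr C$; - $L(x)$ is indecomposable for every object $x$ of $\mathscr C$, and $L(x)\not\cong L(y)$ for distinct objects $x\neq y$ of $\mathscr C$. Write $[x,y]$ for the number of morphisms $x\to y$ in $\mathscr C$, and let $\mu$ be the Möbius function of $\mathscr C$: the integer-valued function on pairs of objects with $\mu(z,y)=0$ whenever $[z,y]=0$, and $\sum_z [x,z]\,\mu(z,y)$ equal to $1$ if $x=y$ and to $0$ otherwise. For an object $x$ put $\delta_x=\sum_z\mu(z,x)\,z$ in the free abelian group on the objects of $\mathscr C$, and extend $x \mapsto [L(x)]\in R(Q)$ to this group by $\mathbb Z$-linearity, denoting the extension again by $L$. Then: 1. The elements $L(\delta_x)$, for $x$ an object of $\mathscr C$, are pairwise orthogonal idempotents of $R(Q)$, and they form a $\mathbb Z$-basis of the subring of $R(Q)$ generated by the elements $[L(x)]$, $x$ an object of $\mathscr C$. Here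 a subring is a non-empty subset closed under subtraction and multiplication (it need not contain $1$). 2. If $(Q,\mathrm{id})$ is an object of $\mathscr C$, then $R(Q)\cong\prod_{x\in\mathscr C}\langle L(\delta_x)\rangle$ as rings, through the map $r\mapsto (r\,L(\delta_x))_{x}$, where $\langle L(\delta_x)\rangle$ is the principal ideal of $R(Q)$ generated by $L(\delta_x)$. -/

import Mathlib

open CategoryTheory
open scoped TensorProduct

universe u v w

namespace QuiverRep

/-! ### Quivers and quivers over a base quiver -/

/-- A finite quiver `(Q₀, Q₁, s, t)`. -/
structure FinQuiver : Type (u + 1) where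
  /-- vertices -/
  V : Type u
  /-- arrows -/
  A : Type u
  /-- start of an arrow -/
  s : A → V
  /-- terminal vertex of an arrow -/
  t : A → V
  [fintypeV : Fintype V]
  [fintypeA : Fintype A]

attribute [instance] FinQuiver.fintypeV FinQuiver.fintypeA

/-- A morphism of quivers. -/
@[ext]
structure FinQuiver.Hom (Q' Q : FinQuiver.{u}) : Type u where
  onV : Q'.V → Q.V
  onA : Q'.A → Q.A
  s_onA : ∀ a, Q.s (onA a) = onV (Q'.s a)
  t_onA : ∀ a, Q.t (onA a) = onV (Q'.t a)

instance : Category.{u} FinQuiver.{u} where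
  Hom := FinQuiver.Hom
  id _ := ⟨fun x => x, fun a => a, fun _ => rfl, fun _ => rfl⟩
  comp f g := ⟨fun x => g.onV (f.onV x), fun a => g.onA (f.onA a),
    fun a => by rw [g.s_onA, f.s_onA], fun a => by rw [g.t_onA, f.t_onA]⟩

/-- The category of quivers over `Q`: objects are quivers `Q'` with a structure map `Q' ⟶ Q`,
morphisms are morphisms of quivers commuting with the structure maps. -/
abbrev QuiverOver (Q : FinQuiver.{u}) : Type (u + 1) := Over Q

/-- The quiver underlying a quiver over `Q`. -/
abbrev QuiverOver.dom {Q : FinQuiver.{u}} (X : QuiverOver Q) : FinQuiver.{u} := X.left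

/-- The structure map of a quiver over `Q`. -/
abbrev QuiverOver.str {Q : FinQuiver.{u}} (X : QuiverOver Q) : FinQuiver.Hom X.dom Q := X.hom

/-- A quiver is connected if it is nonempty and its underlying undirected graph is connected. -/
def FinQuiver.IsConnected (Q : FinQuiver.{u}) : Prop :=
  Nonempty Q.V ∧
    ∀ x y : Q.V, Relation.EqvGen (fun a b => ∃ α : Q.A, Q.s α = a ∧ Q.t α = b) x y

/-- A wrapping: a morphism of quivers which is injective on the set of arrows from `i` to `j`,
for all vertices `i`, `j`. -/
def FinQuiver.Hom.IsWrapping {Q' Q : FinQuiver.{u}} (f : FinQuiver.Hom Q' Q) : Prop :=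
  ∀ i j : Q'.V, Set.InjOn f.onA {α | Q'.s α = i ∧ Q'.t α = j}

open scoped Classical in
/-- The fiber product of two quivers over `Q`. -/
noncomputable def fiberProduct {Q : FinQuiver.{u}} (X Y : QuiverOver Q) : QuiverOver Q :=
  Over.mk (Y := ({
    V := {p : X.dom.V × Y.dom.V // X.str.onV p.1 = Y.str.onV p.2}
    A := {p : X.dom.A × Y.dom.A // X.str.onA p.1 = Y.str.onA p.2}
    s := fun a => ⟨(X.dom.s a.1.1, Y.dom.s a.1.2), by
      rw [← X.str.s_onA, ← Y.str.s_onA, a.2]⟩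
    t := fun a => ⟨(X.dom.t a.1.1, Y.dom.t a.1.2), by
      rw [← X.str.t_onA, ← Y.str.t_onA, a.2]⟩ } : FinQuiver.{u}))
    (show FinQuiver.Hom _ _ from
      { onV := fun p => X.str.onV p.1.1
        onA := fun p => X.str.onA p.1.1
        s_onA := fun a => X.str.s_onA a.1.1
        t_onA := fun a => X.str.t_onA a.1.1 })

/-- The disjoint union of finitely many quivers over `Q` (empty if `n = 0`). -/
def disjointUnion {Q : FinQuiver.{u}} {n : ℕ} (X : Fin n → QuiverOver Q) : QuiverOver Q :=
  Over.mk (Y := ({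
    V := Σ i, (X i).dom.V
    A := Σ i, (X i).dom.A
    s := fun a => ⟨a.1, (X a.1).dom.s a.2⟩
    t := fun a => ⟨a.1, (X a.1).dom.t a.2⟩ } : FinQuiver.{u}))
    (show FinQuiver.Hom _ _ from
      { onV := fun x => (X x.1).str.onV x.2
        onA := fun a => (X a.1).str.onA a.2
        s_onA := fun a => (X a.1).str.s_onA a.2
        t_onA := fun a => (X a.1).str.t_onA a.2 })

/-- A collection of quivers over `Q` is closed under fiber products if the fiber product of any
two members is (isomorphic over `Q` to) a disjoint union of members. -/
def ClosedUnderFiberProducts {Q : FinQuiver.{u}} (C : ObjectProperty (QuiverOver Q)) : Prop :=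
  ∀ X Y : QuiverOver Q, C X → C Y →
    ∃ (n : ℕ) (W : Fin n → QuiverOver Q), (∀ i, C (W i)) ∧
      Nonempty (fiberProduct X Y ≅ disjointUnion W)

/-! ### Representations and the representation ring -/

/-- A (finite dimensional) representation of the quiver `Q` over the field `K`. -/
structure QRep (K : Type u) [Field K] (Q : FinQuiver.{u}) : Type (u + 1) where
  space : Q.V → Type u
  [addCommGroup : ∀ x, AddCommGroup (space x)]
  [module : ∀ x, Module K (space x)]
  [finite : ∀ x, FiniteDimensional K (space x)]
  map : ∀ α : Q.A, space (Q.s α) →ₗ[K] space (Q.t α)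

attribute [instance] QRep.addCommGroup QRep.module QRep.finite

namespace QRep

variable {K : Type u} [Field K] {Q Q' : FinQuiver.{u}}

/-- An isomorphism of representations. -/
structure Iso (V W : QRep K Q) : Type u where
  equiv : ∀ x, V.space x ≃ₗ[K] W.space x
  comm : ∀ (α : Q.A) (v : V.space (Q.s α)),
    equiv (Q.t α) (V.map α v) = W.map α (equiv (Q.s α) v)

/-- The direct sum of two representations. -/
abbrev directSum (V W : QRep K Q) : QRep K Q where
  space x := V.space x × W.space x
  map α := (V.map α).prodMap (W.map α)

/-- The (pointwise) tensor product of two representations. -/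
noncomputable abbrev tensor (V W : QRep K Q) : QRep K Q where
  space x := V.space x ⊗[K] W.space x
  map α := TensorProduct.map (V.map α) (W.map α)

variable (K Q) in
/-- The identity representation: `K` at each vertex and the identity over each arrow. -/
abbrev one : QRep K Q where
  space _ := K
  map _ := LinearMap.id

/-- The zero representation(s). -/
def IsZero (V : QRep K Q) : Prop := ∀ x, Subsingleton (V.space x)

/-- Indecomposable representations. -/
def IsIndecomposable (V : QRep K Q) : Prop :=
  ¬ V.IsZero ∧ ∀ U W : QRep K Q, Nonempty (V.Iso (U.directSum W)) → U.IsZero ∨ W.IsZero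

open scoped Classical in
/-- The pushforward `f_* V` of a representation along a morphism of quivers: its space at `x` is
`⨁_{f y = x} V_y`, and its map over `α` is `∑_{f β = α} φ_β`, where each `φ_β` is extended by
zero. -/
noncomputable abbrev pushforward (f : FinQuiver.Hom Q' Q) (V : QRep K Q') : QRep K Q where
  space x := (y : {y : Q'.V // f.onV y = x}) → V.space y.1
  map α := ∑ β : {β : Q'.A // f.onA β = α},
    (LinearMap.single K (fun y : {y : Q'.V // f.onV y = Q.t α} => V.space y.1)
        ⟨Q'.t β.1, by rw [← f.t_onA, β.2]⟩) ∘ₗ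
      V.map β.1 ∘ₗ
      (LinearMap.proj (φ := fun y : {y : Q'.V // f.onV y = Q.s α} => V.space y.1)
        ⟨Q'.s β.1, by rw [← f.s_onA, β.2]⟩)

variable (K) in
/-- The linearization `L(Q', f') = f'_* 𝟙` of a quiver over `Q`. -/
noncomputable abbrev linearization (X : QuiverOver Q) : QRep K Q :=
  pushforward X.str (one K X.dom)

/-! Isomorphism is an equivalence relation compatible with the operations. -/

namespace Iso

def refl (V : QRep K Q) : V.Iso V := ⟨fun _ => LinearEquiv.refl K _, fun _ _ => rfl⟩

def symm {V W : QRep K Q} (e : V.Iso W) : W.Iso V :=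
  ⟨fun x => (e.equiv x).symm, fun α v => by
    rw [LinearEquiv.symm_apply_eq, e.comm, LinearEquiv.apply_symm_apply]⟩

def trans {U V W : QRep K Q} (e : U.Iso V) (f : V.Iso W) : U.Iso W :=
  ⟨fun x => (e.equiv x).trans (f.equiv x), fun α v => by
    simp only [LinearEquiv.trans_apply, e.comm, f.comm]⟩

noncomputable def tensorCongr {V V' W W' : QRep K Q} (e : V.Iso V') (f : W.Iso W') :
    (V.tensor W).Iso (V'.tensor W') :=
  ⟨fun x => TensorProduct.congr (e.equiv x) (f.equiv x), fun α => LinearMap.congr_fun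
    (show (TensorProduct.congr (e.equiv (Q.t α)) (f.equiv (Q.t α))).toLinearMap ∘ₗ
        TensorProduct.map (V.map α) (W.map α) =
        TensorProduct.map (V'.map α) (W'.map α) ∘ₗ
        (TensorProduct.congr (e.equiv (Q.s α)) (f.equiv (Q.s α))).toLinearMap from
      TensorProduct.ext' fun a b => by simp [e.comm, f.comm])⟩

noncomputable def tensorAssoc (U V W : QRep K Q) :
    ((U.tensor V).tensor W).Iso (U.tensor (V.tensor W)) :=
  ⟨fun x => TensorProduct.assoc K (U.space x) (V.space x) (W.space x), fun α v =>
    LinearMap.congr_fun (TensorProduct.map_map_comp_assoc_eq (U.map α) (V.map α) (W.map α)).symm v⟩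

noncomputable def tensorComm (V W : QRep K Q) : (V.tensor W).Iso (W.tensor V) :=
  ⟨fun x => TensorProduct.comm K (V.space x) (W.space x), fun α v =>
    (TensorProduct.map_comm (W.map α) (V.map α) v).symm⟩

noncomputable def oneTensor (V : QRep K Q) : ((one K Q).tensor V).Iso V :=
  ⟨fun x => TensorProduct.lid K (V.space x), fun α => LinearMap.congr_fun
    (show (TensorProduct.lid K (V.space (Q.t α))).toLinearMap ∘ₗ
        TensorProduct.map LinearMap.id (V.map α) =
        V.map α ∘ₗ (TensorProduct.lid K (V.space (Q.s α))).toLinearMap from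
      TensorProduct.ext' fun a b => by simp)⟩

noncomputable def tensorDirectSum (U V W : QRep K Q) :
    (U.tensor (V.directSum W)).Iso ((U.tensor V).directSum (U.tensor W)) :=
  ⟨fun x => TensorProduct.prodRight K K (U.space x) (V.space x) (W.space x),
    fun α => LinearMap.congr_fun
    (show (TensorProduct.prodRight K K (U.space (Q.t α)) (V.space (Q.t α))
          (W.space (Q.t α))).toLinearMap ∘ₗ
        TensorProduct.map (U.map α) ((V.map α).prodMap (W.map α)) =
        ((TensorProduct.map (U.map α) (V.map α)).prodMap
          (TensorProduct.map (U.map α) (W.map α))) ∘ₗ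
        (TensorProduct.prodRight K K (U.space (Q.s α)) (V.space (Q.s α))
          (W.space (Q.s α))).toLinearMap from
      TensorProduct.ext' fun a b => by simp)⟩

end Iso

end QRep

section RepRing

variable (K : Type u) [Field K] (Q : FinQuiver.{u})

/-- Isomorphism of representations as a setoid. -/
instance repSetoid : Setoid (QRep K Q) where
  r V W := Nonempty (V.Iso W)
  iseqv := ⟨fun V => ⟨QRep.Iso.refl V⟩, fun ⟨e⟩ => ⟨e.symm⟩, fun ⟨e⟩ ⟨f⟩ => ⟨e.trans f⟩⟩

/-- Isomorphism classes of representations of `Q` over `K`. -/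
def IsoClass : Type (u + 1) := Quotient (repSetoid K Q)

variable {K Q} in
/-- The isomorphism class of a representation. -/
def IsoClass.mk (V : QRep K Q) : IsoClass K Q := Quotient.mk (repSetoid K Q) V

/-- Isomorphism classes form a commutative monoid under the tensor product. -/
noncomputable instance : CommMonoid (IsoClass K Q) where
  mul := Quotient.map₂ QRep.tensor fun _ _ ⟨e⟩ _ _ ⟨f⟩ => ⟨e.tensorCongr f⟩
  one := IsoClass.mk (QRep.one K Q)
  mul_assoc a b c := by
    refine Quotient.inductionOn₃ a b c fun U V W => ?_
    exact Quotient.sound ⟨QRep.Iso.tensorAssoc U V W⟩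
  mul_comm a b := by
    refine Quotient.inductionOn₂ a b fun V W => ?_
    exact Quotient.sound ⟨QRep.Iso.tensorComm V W⟩
  one_mul a := by
    refine Quotient.inductionOn a fun V => ?_
    exact Quotient.sound ⟨QRep.Iso.oneTensor V⟩
  mul_one a := by
    refine Quotient.inductionOn a fun V => ?_
    exact Quotient.sound ⟨(QRep.Iso.tensorComm V _).trans (QRep.Iso.oneTensor V)⟩

/-- The subgroup of the free abelian group on isomorphism classes of representations that is
generated by all `[V ⊕ W] - [V] - [W]`. -/
noncomputable def relSubgroup : AddSubgroup (FreeAbelianGroup (IsoClass K Q)) :=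
  AddSubgroup.closure {r | ∃ V W : QRep K Q,
    r = FreeAbelianGroup.of (IsoClass.mk (V.directSum W))
      - FreeAbelianGroup.of (IsoClass.mk V) - FreeAbelianGroup.of (IsoClass.mk W)}

/-- The subgroup `relSubgroup K Q` is an ideal for the multiplication `[V] * [W] = [V ⊗ W]`. -/
noncomputable def relIdeal : Ideal (FreeAbelianGroup (IsoClass K Q)) where
  carrier := relSubgroup K Q
  add_mem' := (relSubgroup K Q).add_mem
  zero_mem' := (relSubgroup K Q).zero_mem
  smul_mem' c x hx := by
    change c * x ∈ relSubgroup K Q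
    induction c using FreeAbelianGroup.induction_on with
    | zero => rw [zero_mul]; exact (relSubgroup K Q).zero_mem
    | neg a ha => rw [neg_mul]; exact (relSubgroup K Q).neg_mem ha
    | add a b ha hb => rw [add_mul]; exact (relSubgroup K Q).add_mem ha hb
    | of a =>
      obtain ⟨U, rfl⟩ : ∃ U, a = IsoClass.mk U := ⟨a.out, (Quotient.out_eq a).symm⟩
      refine AddSubgroup.closure_induction (p := fun x _ =>
        FreeAbelianGroup.of (IsoClass.mk U) * x ∈ relSubgroup K Q) ?_ ?_ ?_ ?_ hx
      · rintro _ ⟨V, W, rfl⟩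
        refine AddSubgroup.subset_closure ⟨U.tensor V, U.tensor W, ?_⟩
        rw [mul_sub, mul_sub, ← FreeAbelianGroup.of_mul, ← FreeAbelianGroup.of_mul,
          ← FreeAbelianGroup.of_mul]
        have h : IsoClass.mk U * IsoClass.mk (V.directSum W)
            = IsoClass.mk ((U.tensor V).directSum (U.tensor W)) :=
          Quotient.sound ⟨QRep.Iso.tensorDirectSum U V W⟩
        rw [h]
        rfl
      · rw [mul_zero]; exact (relSubgroup K Q).zero_mem
      · intro x y _ _ h₁ h₂
        rw [mul_add]; exact (relSubgroup K Q).add_mem h₁ h₂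
      · intro x _ h
        rw [mul_neg]; exact (relSubgroup K Q).neg_mem h

/-- The representation ring `R(Q)`: the free abelian group on isomorphism classes of
representations modulo the relations `[V ⊕ W] = [V] + [W]`, with product `[V] * [W] = [V ⊗ W]`. -/
abbrev RepRing : Type (u + 1) := FreeAbelianGroup (IsoClass K Q) ⧸ relIdeal K Q

variable {K Q} in
/-- The element `[V]` of the representation ring. -/
noncomputable def RepRing.of (V : QRep K Q) : RepRing K Q :=
  Ideal.Quotient.mk (relIdeal K Q) (FreeAbelianGroup.of (IsoClass.mk V))

end RepRing

/-! ### Acyclic categories and the Möbius function -/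

section Mobius

variable (D : Type w) [Category.{v} D]

/-- A category is acyclic if the only endomorphisms are identities and only identities are
invertible. -/
def IsAcyclicCategory : Prop :=
  (∀ (x : D) (f : x ⟶ x), f = 𝟙 x) ∧ ∀ (x y : D) (f : x ⟶ y), IsIso f → x = y

/-- Each object receives morphisms from only finitely many objects. This holds in particular if
the category has finitely many objects. -/
class LowerFinite : Prop where
  finite : ∀ y : D, Finite {x : D // Nonempty (x ⟶ y)}

variable {D}

/-- The objects having a morphism to `y`. -/
abbrev Below (y : D) : Type w := {x : D // Nonempty (x ⟶ y)}

noncomputable instance [LowerFinite D] (y : D) : Fintype (Below y) :=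
  @Fintype.ofFinite _ (LowerFinite.finite y)

/-- The Hom matrix of the full subcategory of objects having a morphism to `y`. -/
noncomputable def homMatrix (y : D) : Matrix (Below y) (Below y) ℤ :=
  Matrix.of fun a b => (Nat.card (a.1 ⟶ b.1) : ℤ)

open scoped Classical in
/-- The Möbius function. Its value `μ(x, y)` is the `(x, y)` entry of the inverse of the Hom matrix
if `x` has a morphism to `y`, and `0` otherwise. Only the objects having a morphism to `y` matter
for `μ(·, y)`, so the Hom matrix is restricted to these objects, which makes it a finite matrix;
if the category is finite this is the same as inverting the full Hom matrix. -/
noncomputable def mobius [LowerFinite D] (x y : D) : ℤ :=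
  if h : Nonempty (x ⟶ y) then (homMatrix y)⁻¹ ⟨x, h⟩ ⟨y, ⟨𝟙 y⟩⟩ else 0

/-- The element `δ_x = ∑_z μ(z, x) z` of the free abelian group on the objects (the additive group
of the Möbius ring). The summands with no morphism `z ⟶ x` vanish. -/
noncomputable def delta [LowerFinite D] (x : D) : D →₀ ℤ :=
  ∑ z : Below x, Finsupp.single z.1 (mobius z.1 x)

end Mobius

/-- The `ℤ`-linear extension of `X ↦ [L(X)]` to the free abelian group on the objects of the full
subcategory `C` of the category of quivers over `Q`. -/
noncomputable def linearizationMap (K : Type u) [Field K] {Q : FinQuiver.{u}}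
    (C : ObjectProperty (QuiverOver Q)) : (C.FullSubcategory →₀ ℤ) →ₗ[ℤ] RepRing K Q :=
  Finsupp.linearCombination ℤ fun X : C.FullSubcategory =>
    RepRing.of (QRep.linearization K X.obj)

end QuiverRep

open QuiverRep

/-! The argument takes place in the table of marks, as for a Burnside ring. A formal combination `a`
of objects has the marks `w ↦ ∑ a_x [w, x]`. Acyclicity makes the matrix of the numbers `[w, x]`
unitriangular, so marks determine `a`, and Möbius inversion says that `δ_x` is the combination whose
marks are the indicator function of `x`. Hence the `δ_x` form a basis, and they are orthogonal
idempotents for pointwise multiplication of marks.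

This multiplication is the one seen in `R(Q)`. Morphisms into a fiber product are pairs of
morphisms, and a morphism from a connected quiver into a disjoint union lands in exactly one
summand. So if `X ×_Q Y` is the disjoint union of objects `Z_i`, the combination `∑ Z_i` has the
product of the marks of `X` and `Y`. On the other side, `L` turns fiber products into tensor
products and disjoint unions into direct sums, so `L(∑ Z_i) = L(X) L(Y)`. No product is put on the
free abelian group: `exists_mark_eq_mul` only asserts that some `p` has both properties, and
`ext_mark` makes it unique. Thus the `L(δ_x)` are orthogonal idempotents spanning the generated
subring.

Independence of the `L(δ_x)` amounts to injectivity of `L`, that is, to independence of the classes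
of non-isomorphic indecomposables. Instead of decomposing representations, one uses the additive
invariant `dim Hom(X, M) - dim rad(X, M)`; it is nonzero at `M = X` and zero at every indecomposable
`M` not isomorphic to `X`. Its additivity rests on Fitting's lemma.

If `(Q, id)` is an object, it is terminal, so all its marks are 1 and it equals the sum of all
`δ_x`. As `L(Q, id) = 1`, the idempotents are complete and split the ring. -/

namespace QuiverRep

/-! ### Marks and Möbius inversion in an acyclic category. -/

section MobiusInversion

variable {D : Type w} [Category.{v} D]

/-- The preorder "there is a morphism `x ⟶ y`" of an acyclic category is antisymmetric. -/
theorem IsAcyclicCategory.eq_of_nonempty_hom (h : IsAcyclicCategory D) {x y : D}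
    (f : Nonempty (x ⟶ y)) (g : Nonempty (y ⟶ x)) : x = y := by
  obtain ⟨f⟩ := f
  obtain ⟨g⟩ := g
  exact h.2 x y f ⟨g, h.1 x _, h.1 y _⟩

theorem IsAcyclicCategory.card_end (h : IsAcyclicCategory D) (x : D) :
    Nat.card (x ⟶ x) = 1 :=
  Nat.card_eq_one_iff_unique.2 ⟨⟨fun f g => by rw [h.1 x f, h.1 x g]⟩, ⟨𝟙 x⟩⟩

/-- The order in which `x ≤ y` if there is a morphism `x ⟶ y`. -/
abbrev IsAcyclicCategory.partialOrder (h : IsAcyclicCategory D) : PartialOrder D where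
  le x y := Nonempty (x ⟶ y)
  le_refl x := ⟨𝟙 x⟩
  le_trans _ _ _ := fun ⟨f⟩ ⟨g⟩ => ⟨f ≫ g⟩
  le_antisymm _ _ := h.eq_of_nonempty_hom

theorem IsAcyclicCategory.exists_linearOrder (h : IsAcyclicCategory D) :
    ∃ _ : LinearOrder D, ∀ x y : D, Nonempty (x ⟶ y) → x ≤ y := by
  let po : PartialOrder D := h.partialOrder
  exact ⟨show LinearOrder (LinearExtension D) from inferInstance, fun x y hxy =>
    (toLinearExtension (α := D)).monotone (show po.le x y from hxy)⟩

theorem card_hom_eq_zero {x y : D} (h : ¬ Nonempty (x ⟶ y)) : Nat.card (x ⟶ y) = 0 := by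
  have := not_nonempty_iff.1 h
  exact Nat.card_of_isEmpty

/-- In a linear extension of the reachability order the matrix is upper triangular, with ones on the
diagonal because the only endomorphisms are identities. The matrix inverse used in `mobius` is
therefore a genuine inverse over the integers. -/
theorem det_homMatrix [LowerFinite D] (h : IsAcyclicCategory D) (y : D)
    [inst : DecidableEq (Below y)] : (homMatrix y).det = 1 := by
  obtain ⟨_, hmono⟩ := h.exists_linearOrder
  have htri : (homMatrix y).IsUpperTriangular := by
    intro a b hab
    have : ¬ Nonempty (a.1 ⟶ b.1) := fun hf => not_lt_of_ge (hmono a.1 b.1 hf) hab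
    simp [homMatrix, card_hom_eq_zero this]
  have hdet := Matrix.det_of_isUpperTriangular htri
  simp only [homMatrix, Matrix.of_apply, h.card_end, Nat.cast_one, Finset.prod_const_one] at hdet
  convert hdet
  rfl

-- Confirms that the matrix definition of `mobius` satisfies the defining recursion for all `x`,
-- also those outside `Below y`: there every term vanishes, since `x ⟶ z ⟶ y` would put `x` below
-- `y`.
open scoped Classical in
theorem sum_card_hom_mul_mobius [LowerFinite D] (h : IsAcyclicCategory D) (x y : D) :
    ∑ z : Below y, (Nat.card (x ⟶ z.1) : ℤ) * mobius z.1 y = if x = y then 1 else 0 := by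
  by_cases hxy : Nonempty (x ⟶ y)
  · have hinv : homMatrix y * (homMatrix y)⁻¹ = 1 :=
      Matrix.mul_nonsing_inv _ (by rw [det_homMatrix h]; exact isUnit_one)
    have hentry := congrFun (congrFun hinv ⟨x, hxy⟩) ⟨y, ⟨𝟙 y⟩⟩
    rw [Matrix.mul_apply, Matrix.one_apply] at hentry
    simp only [Subtype.mk.injEq] at hentry
    rw [← hentry]
    refine Finset.sum_congr rfl fun z _ => ?_
    rw [mobius, dif_pos z.2]
    rfl
  · rw [if_neg (by rintro rfl; exact hxy ⟨𝟙 x⟩)]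
    refine Finset.sum_eq_zero fun z _ => ?_
    rw [card_hom_eq_zero (fun ⟨f⟩ => hxy (z.2.map fun g => f ≫ g)), Nat.cast_zero, zero_mul]

/-- The mark homomorphism `x ↦ [w, x]` on the free abelian group on the objects. -/
noncomputable def mark (w : D) : (D →₀ ℤ) →ₗ[ℤ] ℤ :=
  Finsupp.linearCombination ℤ fun x => (Nat.card (w ⟶ x) : ℤ)

theorem mark_single (w x : D) (n : ℤ) :
    mark w (Finsupp.single x n) = n * Nat.card (w ⟶ x) := by
  simp [mark]

open scoped Classical in
theorem mark_delta [LowerFinite D] (h : IsAcyclicCategory D) (w x : D) :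
    mark w (delta x) = if w = x then 1 else 0 := by
  rw [← sum_card_hom_mul_mobius h, delta, map_sum]
  exact Finset.sum_congr rfl fun z _ => by rw [mark_single, mul_comm]

/-- At a maximal object `m` of the support, no other object of the support receives a morphism from
`m`, so the mark at `m` is just the coefficient of `m`. -/
theorem eq_zero_of_mark_eq_zero (h : IsAcyclicCategory D) {a : D →₀ ℤ}
    (ha : ∀ w, mark w a = 0) : a = 0 := by
  by_contra hne
  let : PartialOrder D := h.partialOrder
  obtain ⟨m, hm⟩ := a.support.exists_maximal (Finsupp.support_nonempty_iff.2 hne)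
  refine Finsupp.mem_support_iff.1 hm.1 ?_
  rw [← ha m, mark, Finsupp.linearCombination_apply, Finsupp.sum, Finset.sum_eq_single m]
  · simp [h.card_end]
  · intro x hx hxm
    rw [card_hom_eq_zero (fun hf => hxm (hm.eq_of_ge hx hf)), Nat.cast_zero, smul_zero]
  · intro hm'
    exact absurd hm.1 hm'

theorem ext_mark (h : IsAcyclicCategory D) {a b : D →₀ ℤ} (hab : ∀ w, mark w a = mark w b) :
    a = b :=
  sub_eq_zero.1 <| eq_zero_of_mark_eq_zero h fun w => by rw [map_sub, hab, sub_self]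

theorem single_eq_sum_delta [LowerFinite D] (h : IsAcyclicCategory D) (x : D) :
    Finsupp.single x (1 : ℤ) = ∑ z : Below x, (Nat.card (z.1 ⟶ x) : ℤ) • delta z.1 := by
  classical
  refine ext_mark h fun w => ?_
  simp only [map_sum, map_smul, mark_delta h, mark_single, one_mul, smul_eq_mul]
  by_cases hw : Nonempty (w ⟶ x)
  · rw [Finset.sum_eq_single ⟨w, hw⟩] <;> simp
    intro a ha hne h'
    exact absurd h'.symm hne
  · rw [card_hom_eq_zero hw, Finset.sum_eq_zero]
    · simp
    · intro z _
      rw [if_neg (by rintro rfl; exact hw z.2), mul_zero]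

/-- If `(w, x) ↦ [w, x]` and `l` are compatible with products of basis elements, then they are
compatible with products of arbitrary elements. -/
theorem exists_mark_eq_mul {R : Type*} [CommRing R] (l : (D →₀ ℤ) →ₗ[ℤ] R)
    (hl : ∀ x y : D, ∃ p : D →₀ ℤ,
      (∀ w : D, mark w p = (Nat.card (w ⟶ x) : ℤ) * Nat.card (w ⟶ y)) ∧
      l p = l (Finsupp.single x 1) * l (Finsupp.single y 1)) (a b : D →₀ ℤ) :
    ∃ p : D →₀ ℤ, (∀ w, mark w p = mark w a * mark w b) ∧ l p = l a * l b := by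
  induction a using Finsupp.induction_linear with
  | zero => exact ⟨0, by simp⟩
  | add a₁ a₂ h₁ h₂ =>
    obtain ⟨p₁, hp₁, hq₁⟩ := h₁
    obtain ⟨p₂, hp₂, hq₂⟩ := h₂
    exact ⟨p₁ + p₂, fun w => by rw [map_add, map_add, add_mul, hp₁, hp₂],
      by rw [map_add, map_add, add_mul, hq₁, hq₂]⟩
  | single x m =>
    induction b using Finsupp.induction_linear with
    | zero => exact ⟨0, by simp⟩
    | add b₁ b₂ h₁ h₂ =>
      obtain ⟨p₁, hp₁, hq₁⟩ := h₁
      obtain ⟨p₂, hp₂, hq₂⟩ := h₂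
      exact ⟨p₁ + p₂, fun w => by rw [map_add, map_add, mul_add, hp₁, hp₂],
        by rw [map_add, map_add, mul_add, hq₁, hq₂]⟩
    | single y n =>
      obtain ⟨p, hp, hq⟩ := hl x y
      refine ⟨(m * n) • p, fun w => ?_, ?_⟩
      · rw [map_smul, hp, mark_single, mark_single, smul_eq_mul]
        ring
      · rw [map_smul, hq, ← Finsupp.smul_single_one x m, ← Finsupp.smul_single_one y n, map_smul,
          map_smul, smul_mul_smul_comm]

/-- An additive map from the free abelian group on the objects to a commutative ring, which is
multiplicative with respect to the marks, maps the `δ_x` to orthogonal idempotents. -/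
theorem delta_orthogonalIdempotents [LowerFinite D] (h : IsAcyclicCategory D)
    {R : Type*} [CommRing R] (l : (D →₀ ℤ) →ₗ[ℤ] R)
    (hl : ∀ a b : D →₀ ℤ, ∃ p : D →₀ ℤ, (∀ w, mark w p = mark w a * mark w b) ∧ l p = l a * l b) :
    OrthogonalIdempotents fun x : D => l (delta x) := by
  classical
  refine ⟨fun x => ?_, fun x y hxy => ?_⟩
  · obtain ⟨p, hp, hq⟩ := hl (delta x) (delta x)
    -- The marks of `δ_x` are 0 or 1, so squaring does not change them and `p` is `δ_x` itself.
    refine hq.symm.trans (congrArg l (ext_mark h fun w => ?_))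
    rw [hp, mark_delta h]
    split_ifs <;> simp
  · obtain ⟨p, hp, hq⟩ := hl (delta x) (delta y)
    refine hq.symm.trans ?_
    rw [← map_zero l]
    refine congrArg l (ext_mark h fun w => ?_)
    rw [hp, mark_delta h, mark_delta h, map_zero]
    split_ifs with h₁ h₂
    · exact absurd (h₁.symm.trans h₂) hxy
    all_goals simp

/-- The elements `δ_x` form a basis of the free abelian group on the objects. -/
noncomputable def deltaBasis [LowerFinite D] (h : IsAcyclicCategory D) :
    Module.Basis D ℤ (D →₀ ℤ) :=
  Module.Basis.mk (v := delta)
    (by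
      classical
      rw [linearIndependent_iff]
      intro c hc
      ext x
      -- The marks are dual to the `δ`'s, so `mark x` extracts the coefficient at `x`.
      have := congrArg (mark x) hc
      rw [Finsupp.linearCombination_apply, Finsupp.sum, map_sum, map_zero] at this
      simp only [map_smul, mark_delta h, smul_eq_mul, mul_ite, mul_one, mul_zero,
        Finset.sum_ite_eq] at this
      by_contra hx
      rw [if_pos (Finsupp.mem_support_iff.2 hx)] at this
      exact hx this)
    (by
      rw [← (Finsupp.basisSingleOne (ι := D) (R := ℤ)).span_eq, Submodule.span_le]
      rintro _ ⟨x, rfl⟩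
      rw [Finsupp.coe_basisSingleOne, SetLike.mem_coe]
      beta_reduce
      rw [single_eq_sum_delta h]
      exact sum_mem fun z _ => Submodule.smul_mem _ _ (Submodule.subset_span ⟨z.1, rfl⟩))

theorem deltaBasis_apply [LowerFinite D] (h : IsAcyclicCategory D) (x : D) :
    deltaBasis h x = delta x :=
  Module.Basis.mk_apply _ _ x

/-- Every mark of either side is 1. -/
theorem sum_delta_of_isTerminal [LowerFinite D] (h : IsAcyclicCategory D) [Fintype D] {t : D}
    (ht : Limits.IsTerminal t) : ∑ x : D, delta x = Finsupp.single t 1 := by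
  classical
  refine ext_mark h fun w => ?_
  have : Nat.card (w ⟶ t) = 1 := Nat.card_eq_one_iff_unique.2
    ⟨⟨fun f g => ht.hom_ext f g⟩, ⟨ht.from w⟩⟩
  simp [mark_delta h, mark_single, this]

theorem finite_of_isTerminal [LowerFinite D] {t : D} (ht : Limits.IsTerminal t) : Finite D :=
  have := LowerFinite.finite t
  Finite.of_injective (fun x : D => (⟨x, ⟨ht.from x⟩⟩ : Below t)) fun _ _ hxy =>
    congrArg Subtype.val hxy

/-- The range of a map compatible with products is the subring generated by the images of the
objects. -/
theorem mem_closure_iff_mem_range {ι R : Type*} [CommRing R] (l : (ι →₀ ℤ) →ₗ[ℤ] R)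
    (hl : ∀ a b : ι →₀ ℤ, ∃ p : ι →₀ ℤ, l p = l a * l b) (r : R) :
    r ∈ NonUnitalSubring.closure (Set.range fun x : ι => l (Finsupp.single x 1)) ↔
      ∃ a, l a = r := by
  constructor
  · intro hr
    induction hr using NonUnitalSubring.closure_induction with
    | mem r hr =>
      obtain ⟨x, rfl⟩ := hr
      exact ⟨_, rfl⟩
    | zero => exact ⟨0, map_zero l⟩
    | add r s _ _ hr hs =>
      obtain ⟨a, rfl⟩ := hr
      obtain ⟨b, rfl⟩ := hs
      exact ⟨a + b, map_add l a b⟩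
    | neg r _ hr =>
      obtain ⟨a, rfl⟩ := hr
      exact ⟨-a, map_neg l a⟩
    | mul r s _ _ hr hs =>
      obtain ⟨a, rfl⟩ := hr
      obtain ⟨b, rfl⟩ := hs
      exact hl a b
  · rintro ⟨a, rfl⟩
    induction a using Finsupp.induction_linear with
    | zero => rw [map_zero]; exact zero_mem _
    | add a b ha hb => rw [map_add]; exact add_mem ha hb
    | single x n =>
      rw [← mul_one n, ← smul_eq_mul, ← Finsupp.smul_single, map_smul]
      exact zsmul_mem (NonUnitalSubring.subset_closure (Set.mem_range_self x)) n

/-- If `l` is moreover injective, the images of the `δ_x` form a basis of the subring generated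
by the images of the objects. -/
theorem exists_basis_closure [LowerFinite D] (h : IsAcyclicCategory D)
    {R : Type*} [CommRing R] (l : (D →₀ ℤ) →ₗ[ℤ] R)
    (hl : ∀ a b : D →₀ ℤ, ∃ p : D →₀ ℤ, l p = l a * l b) (hinj : Function.Injective l) :
    ∃ b : Module.Basis D ℤ
        (NonUnitalSubring.closure (Set.range fun x : D => l (Finsupp.single x 1))),
      ∀ x, (b x : R) = l (delta x) := by
  let f : (D →₀ ℤ) →+
      NonUnitalSubring.closure (Set.range fun x : D => l (Finsupp.single x 1)) :=
    { toFun := fun a => ⟨l a, (mem_closure_iff_mem_range l hl _).2 ⟨a, rfl⟩⟩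
      map_zero' := Subtype.ext (map_zero l)
      map_add' := fun a b => Subtype.ext (map_add l a b) }
  have hf : Function.Bijective f.toIntLinearMap :=
    ⟨fun a b hab => hinj (congrArg Subtype.val hab), fun ⟨r, hr⟩ => by
      obtain ⟨a, ha⟩ := (mem_closure_iff_mem_range l hl r).1 hr
      exact ⟨a, Subtype.ext ha⟩⟩
  refine ⟨(deltaBasis h).map (LinearEquiv.ofBijective f.toIntLinearMap hf), fun x => ?_⟩
  rw [Module.Basis.map_apply, deltaBasis_apply]
  rfl

end MobiusInversion

/-! ### Splitting a ring along complete orthogonal idempotents. -/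

/-- A finite complete family of orthogonal idempotents decomposes a commutative ring into the
product of the ideals they generate. -/
theorem exists_ringEquiv_pi_span {ι R : Type*} [CommRing R] [Fintype ι] {e : ι → R}
    (he : CompleteOrthogonalIdempotents e) :
    ∃ Φ : R ≃+* ((i : ι) → (Ideal.span {e i} : Ideal R)), ∀ r i, (Φ r i : R) = r * e i := by
  classical
  -- The idempotent `e i` acts as a unit on the ideal it generates.
  have hmem : ∀ (i : ι) (x : (Ideal.span {e i} : Ideal R)), (x : R) * e i = x := by
    intro i x
    obtain ⟨a, ha⟩ := Ideal.mem_span_singleton'.1 x.2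
    rw [← ha, mul_assoc, (he.idem i).eq]
  refine ⟨{
    toFun := fun r i => ⟨r * e i, Ideal.mem_span_singleton'.2 ⟨r, rfl⟩⟩
    invFun := fun x => ∑ i, (x i : R)
    left_inv := fun r => by
      change ∑ i, r * e i = r
      rw [← Finset.mul_sum, he.complete, mul_one]
    right_inv := fun x => by
      funext i
      refine Subtype.ext ?_
      change (∑ j, (x j : R)) * e i = x i
      rw [Finset.sum_mul, Finset.sum_eq_single i]
      · exact hmem i (x i)
      · intro j _ hji
        rw [← hmem j (x j), mul_assoc, he.ortho hji, mul_zero]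
      · simp
    map_mul' := fun r s => by
      funext i
      refine Subtype.ext ?_
      change r * s * e i = r * e i * (s * e i)
      rw [mul_mul_mul_comm, (he.idem i).eq]
    map_add' := fun r s => by
      funext i
      exact Subtype.ext (add_mul r s (e i)) }, fun r i => rfl⟩


end QuiverRep

namespace QuiverRep

/-! ### Counting morphisms into fiber products and disjoint unions. -/

section Counting

variable {Q : FinQuiver.{u}}

@[ext]
theorem FinQuiver.hom_ext {X Y : FinQuiver.{u}} {f g : X ⟶ Y}
    (hV : ∀ x, FinQuiver.Hom.onV f x = FinQuiver.Hom.onV g x)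
    (hA : ∀ a, FinQuiver.Hom.onA f a = FinQuiver.Hom.onA g a) : f = g :=
  FinQuiver.Hom.ext (funext hV) (funext hA)

instance (X Y : FinQuiver.{u}) : Finite (X ⟶ Y) :=
  Finite.of_injective
    (fun f : X ⟶ Y => (FinQuiver.Hom.onV f, FinQuiver.Hom.onA f)) fun _ _ h =>
      FinQuiver.Hom.ext (congrArg Prod.fst h) (congrArg Prod.snd h)

/-- The map on vertices of a morphism of quivers over `Q`. -/
abbrev QuiverOver.onV {X Y : QuiverOver Q} (f : X ⟶ Y) : X.dom.V → Y.dom.V :=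
  FinQuiver.Hom.onV f.left

/-- The map on arrows of a morphism of quivers over `Q`. -/
abbrev QuiverOver.onA {X Y : QuiverOver Q} (f : X ⟶ Y) : X.dom.A → Y.dom.A :=
  FinQuiver.Hom.onA f.left

theorem QuiverOver.str_onV {X Y : QuiverOver Q} (f : X ⟶ Y) (x : X.dom.V) :
    Y.str.onV (QuiverOver.onV f x) = X.str.onV x :=
  congrArg (fun g : FinQuiver.Hom X.dom Q => g.onV x) (Over.w f)

theorem QuiverOver.str_onA {X Y : QuiverOver Q} (f : X ⟶ Y) (a : X.dom.A) :
    Y.str.onA (QuiverOver.onA f a) = X.str.onA a :=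
  congrArg (fun g : FinQuiver.Hom X.dom Q => g.onA a) (Over.w f)

theorem QuiverOver.s_onA {X Y : QuiverOver Q} (f : X ⟶ Y) (a : X.dom.A) :
    Y.dom.s (QuiverOver.onA f a) = QuiverOver.onV f (X.dom.s a) :=
  FinQuiver.Hom.s_onA f.left a

theorem QuiverOver.t_onA {X Y : QuiverOver Q} (f : X ⟶ Y) (a : X.dom.A) :
    Y.dom.t (QuiverOver.onA f a) = QuiverOver.onV f (X.dom.t a) :=
  FinQuiver.Hom.t_onA f.left a

theorem QuiverOver.hom_ext {X Y : QuiverOver Q} {f g : X ⟶ Y}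
    (hV : ∀ x, QuiverOver.onV f x = QuiverOver.onV g x)
    (hA : ∀ a, QuiverOver.onA f a = QuiverOver.onA g a) : f = g :=
  Over.OverMorphism.ext (FinQuiver.hom_ext hV hA)

/-- Constructor for morphisms of quivers over `Q`. -/
abbrev QuiverOver.homMk {X Y : QuiverOver Q} (V : X.dom.V → Y.dom.V) (A : X.dom.A → Y.dom.A)
    (hs : ∀ a, Y.dom.s (A a) = V (X.dom.s a)) (ht : ∀ a, Y.dom.t (A a) = V (X.dom.t a))
    (hV : ∀ x, Y.str.onV (V x) = X.str.onV x) (hA : ∀ a, Y.str.onA (A a) = X.str.onA a) :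
    X ⟶ Y :=
  Over.homMk (show FinQuiver.Hom X.dom Y.dom from ⟨V, A, hs, ht⟩)
    (FinQuiver.hom_ext hV hA)

/-- Needed for additivity of `Nat.card` over disjoint unions, since `Nat.card` is 0 on infinite
types. -/
instance (X Y : QuiverOver Q) : Finite (X ⟶ Y) :=
  Finite.of_injective (fun f : X ⟶ Y => f.left) fun _ _ h => Over.OverMorphism.ext h

/-- The universal property of the fiber product. -/
noncomputable def homFiberProductEquiv (W X Y : QuiverOver Q) :
    (W ⟶ fiberProduct X Y) ≃ (W ⟶ X) × (W ⟶ Y) where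
  toFun f :=
    (QuiverOver.homMk (fun w => (QuiverOver.onV f w).1.1) (fun a => (QuiverOver.onA f a).1.1)
      (fun a => congrArg (fun p => p.1.1) (QuiverOver.s_onA f a))
      (fun a => congrArg (fun p => p.1.1) (QuiverOver.t_onA f a))
      (fun w => QuiverOver.str_onV f w) (fun a => QuiverOver.str_onA f a),
    QuiverOver.homMk (fun w => (QuiverOver.onV f w).1.2) (fun a => (QuiverOver.onA f a).1.2)
      (fun a => congrArg (fun p => p.1.2) (QuiverOver.s_onA f a))
      (fun a => congrArg (fun p => p.1.2) (QuiverOver.t_onA f a))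
      (fun w => (QuiverOver.onV f w).2.symm.trans (QuiverOver.str_onV f w))
      (fun a => (QuiverOver.onA f a).2.symm.trans (QuiverOver.str_onA f a)))
  invFun p := QuiverOver.homMk
    (fun w => ⟨(QuiverOver.onV p.1 w, QuiverOver.onV p.2 w),
      (QuiverOver.str_onV p.1 w).trans (QuiverOver.str_onV p.2 w).symm⟩)
    (fun a => ⟨(QuiverOver.onA p.1 a, QuiverOver.onA p.2 a),
      (QuiverOver.str_onA p.1 a).trans (QuiverOver.str_onA p.2 a).symm⟩)
    (fun a => Subtype.ext (Prod.ext (QuiverOver.s_onA p.1 a) (QuiverOver.s_onA p.2 a)))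
    (fun a => Subtype.ext (Prod.ext (QuiverOver.t_onA p.1 a) (QuiverOver.t_onA p.2 a)))
    (fun w => QuiverOver.str_onV p.1 w) (fun a => QuiverOver.str_onA p.1 a)
  left_inv _ := QuiverOver.hom_ext (fun _ => rfl) (fun _ => rfl)
  right_inv _ := Prod.ext (QuiverOver.hom_ext (fun _ => rfl) (fun _ => rfl))
    (QuiverOver.hom_ext (fun _ => rfl) (fun _ => rfl))

/-- The inclusion of a summand into the disjoint union. -/
def disjointUnionInclusion {n : ℕ} (X : Fin n → QuiverOver Q) (i : Fin n) :
    X i ⟶ disjointUnion X :=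
  QuiverOver.homMk (fun x => ⟨i, x⟩) (fun a => ⟨i, a⟩) (fun _ => rfl) (fun _ => rfl)
    (fun _ => rfl) (fun _ => rfl)

/-- A morphism from a connected quiver to a disjoint union lands in a single summand. -/
theorem exists_factor_of_isConnected {W : QuiverOver Q} (hW : W.dom.IsConnected) {n : ℕ}
    (X : Fin n → QuiverOver Q) (f : W ⟶ disjointUnion X) :
    ∃ i, ∃ g : W ⟶ X i, g ≫ disjointUnionInclusion X i = f := by
  obtain ⟨⟨w₀⟩, hW⟩ := hW
  have hA : ∀ a, (QuiverOver.onA f a).1 = (QuiverOver.onV f (W.dom.s a)).1 := fun a =>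
    congrArg Sigma.fst (QuiverOver.s_onA f a)
  have hA' : ∀ a, (QuiverOver.onA f a).1 = (QuiverOver.onV f (W.dom.t a)).1 := fun a =>
    congrArg Sigma.fst (QuiverOver.t_onA f a)
  -- The index of the summand is the same at both ends of an arrow, hence constant on a connected
  -- quiver.
  have hconst : ∀ x y, Relation.EqvGen (fun a b => ∃ α : W.dom.A, W.dom.s α = a ∧ W.dom.t α = b)
      x y → (QuiverOver.onV f x).1 = (QuiverOver.onV f y).1 := by
    intro x y hxy
    induction hxy with
    | rel x y h =>
      obtain ⟨α, rfl, rfl⟩ := h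
      exact (hA α).symm.trans (hA' α)
    | refl x => rfl
    | symm x y _ h => exact h.symm
    | trans x y z _ _ h₁ h₂ => exact h₁.trans h₂
  have hV : ∀ w, ∃ x : (X (QuiverOver.onV f w₀).1).dom.V,
      (⟨_, x⟩ : Σ i, (X i).dom.V) = QuiverOver.onV f w := by
    intro w
    have h := hconst w₀ w (hW _ _)
    rw [h]
    exact ⟨_, rfl⟩
  have hA₀ : ∀ a, ∃ x : (X (QuiverOver.onV f w₀).1).dom.A,
      (⟨_, x⟩ : Σ i, (X i).dom.A) = QuiverOver.onA f a := by
    intro a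
    have h := (hconst w₀ _ (hW _ _)).trans (hA a).symm
    rw [h]
    exact ⟨_, rfl⟩
  choose gV hgV using hV
  choose gA hgA using hA₀
  refine ⟨_, QuiverOver.homMk gV gA (fun a => ?_) (fun a => ?_) (fun w => ?_) (fun a => ?_),
    QuiverOver.hom_ext hgV hgA⟩
  · have h := QuiverOver.s_onA f a
    rw [← hgV, ← hgA] at h
    exact eq_of_heq (Sigma.mk.inj h).2
  · have h := QuiverOver.t_onA f a
    rw [← hgV, ← hgA] at h
    exact eq_of_heq (Sigma.mk.inj h).2
  · have h := QuiverOver.str_onV f w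
    rw [← hgV] at h
    exact h
  · have h := QuiverOver.str_onA f a
    rw [← hgA] at h
    exact h

theorem card_hom_fiberProduct (W X Y : QuiverOver Q) :
    Nat.card (W ⟶ fiberProduct X Y) = Nat.card (W ⟶ X) * Nat.card (W ⟶ Y) := by
  rw [Nat.card_congr (homFiberProductEquiv W X Y), Nat.card_prod]

theorem card_hom_disjointUnion {W : QuiverOver Q} (hW : W.dom.IsConnected) {n : ℕ}
    (X : Fin n → QuiverOver Q) :
    Nat.card (W ⟶ disjointUnion X) = ∑ i, Nat.card (W ⟶ X i) := by
  rw [← Nat.card_sigma]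
  refine (Nat.card_congr (Equiv.ofBijective
    (fun p : Σ i, (W ⟶ X i) => p.2 ≫ disjointUnionInclusion X p.1) ⟨?_, ?_⟩)).symm
  · rintro ⟨i, f⟩ ⟨j, g⟩ h
    have hV : ∀ w, (⟨i, QuiverOver.onV f w⟩ : Σ i, (X i).dom.V) = ⟨j, QuiverOver.onV g w⟩ := fun w =>
      congrArg (fun k : W ⟶ disjointUnion X => QuiverOver.onV k w) h
    have hA : ∀ a, (⟨i, QuiverOver.onA f a⟩ : Σ i, (X i).dom.A) = ⟨j, QuiverOver.onA g a⟩ := fun a =>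
      congrArg (fun k : W ⟶ disjointUnion X => QuiverOver.onA k a) h
    -- A vertex is needed to recover the index: the empty quiver maps into a union through every
    -- summand.
    obtain ⟨w₀⟩ := hW.1
    obtain rfl : i = j := congrArg Sigma.fst (hV w₀)
    refine congrArg (Sigma.mk i) (QuiverOver.hom_ext (fun w => ?_) (fun a => ?_))
    · exact eq_of_heq (Sigma.mk.inj (hV w)).2
    · exact eq_of_heq (Sigma.mk.inj (hA a)).2
  · intro f
    obtain ⟨i, g, hg⟩ := exists_factor_of_isConnected hW X f
    exact ⟨⟨i, g⟩, hg⟩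

theorem card_hom_congr {W X Y : QuiverOver Q} (e : X ≅ Y) :
    Nat.card (W ⟶ X) = Nat.card (W ⟶ Y) :=
  Nat.card_congr e.homToEquiv

theorem card_fullSubcategory_hom {C : ObjectProperty (QuiverOver Q)} (X Y : C.FullSubcategory) :
    Nat.card (X ⟶ Y) = Nat.card (X.obj ⟶ Y.obj) :=
  Nat.card_congr C.fullyFaithfulι.homEquiv

end Counting

end QuiverRep

namespace QuiverRep

/-! ### Linearizations recognized by bases on which arrows act combinatorially. -/

section Linearization

variable {K : Type u} [Field K] {Q Q' : FinQuiver.{u}}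

/-- The vertices of `Q'` over the vertex `x` of `Q`. -/
abbrev FinQuiver.Hom.FiberV (f : FinQuiver.Hom Q' Q) (x : Q.V) : Type u := {y : Q'.V // f.onV y = x}

/-- The arrows of `Q'` over the arrow `α` of `Q`. -/
abbrev FinQuiver.Hom.FiberA (f : FinQuiver.Hom Q' Q) (α : Q.A) : Type u :=
  {β : Q'.A // f.onA β = α}

/-- The start of an arrow over `α`, as a vertex over `s α`. -/
abbrev FinQuiver.Hom.fiberS (f : FinQuiver.Hom Q' Q) {α : Q.A} (β : f.FiberA α) :
    f.FiberV (Q.s α) := ⟨Q'.s β.1, by rw [← f.s_onA, β.2]⟩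

/-- The terminal vertex of an arrow over `α`, as a vertex over `t α`. -/
abbrev FinQuiver.Hom.fiberT (f : FinQuiver.Hom Q' Q) {α : Q.A} (β : f.FiberA α) :
    f.FiberV (Q.t α) := ⟨Q'.t β.1, by rw [← f.t_onA, β.2]⟩

open scoped Classical in
/-- A family of bases of the spaces of `V`, indexed by the vertices of `Q'` and permuted by the
maps of `V` in the way the basis vectors of the linearization of `Q'` are. -/
structure LinearizationBasis (X : QuiverOver Q) (V : QRep K Q) where
  basis : ∀ x, Module.Basis (X.str.FiberV x) K (V.space x)
  map_basis : ∀ (α : Q.A) (y : X.str.FiberV (Q.s α)), V.map α (basis _ y) =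
    ∑ β : X.str.FiberA α, if X.str.fiberS β = y then basis _ (X.str.fiberT β) else 0

variable (K) in
open scoped Classical in
/-- The standard bases of a linearization. -/
noncomputable def LinearizationBasis.standard (X : QuiverOver Q) :
    LinearizationBasis X (QRep.linearization K X) where
  basis x := Pi.basisFun K (X.str.FiberV x)
  map_basis α y := by
    rw [LinearMap.sum_apply]
    refine Finset.sum_congr rfl fun β _ => ?_
    simp only [Pi.basisFun_apply, LinearMap.comp_apply, LinearMap.proj_apply,
      LinearMap.id_apply, LinearMap.single_apply]
    split_ifs with h
    · rw [← h, Pi.single_eq_same]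
    · rw [Pi.single_eq_of_ne h, Pi.single_zero]

/-- Two representations with bases modelled on the same quiver over `Q` are isomorphic. -/
noncomputable def LinearizationBasis.iso {X : QuiverOver Q} {V W : QRep K Q}
    (b : LinearizationBasis X V) (c : LinearizationBasis X W) : V.Iso W where
  equiv x := (b.basis x).equiv (c.basis x) (Equiv.refl _)
  comm α := LinearMap.congr_fun (show
      ((b.basis (Q.t α)).equiv (c.basis (Q.t α)) (Equiv.refl _)).toLinearMap ∘ₗ V.map α =
        W.map α ∘ₗ ((b.basis (Q.s α)).equiv (c.basis (Q.s α)) (Equiv.refl _)).toLinearMap from by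
    refine (b.basis (Q.s α)).ext fun y => ?_
    simp only [LinearMap.comp_apply, LinearEquiv.coe_coe, b.map_basis, Module.Basis.equiv_apply,
      Equiv.refl_apply, c.map_basis, map_sum]
    refine Finset.sum_congr rfl fun β _ => ?_
    split_ifs
    · rw [Module.Basis.equiv_apply, Equiv.refl_apply]
    · rw [map_zero])

/-- Transport of bases along an isomorphism of quivers over `Q`. -/
noncomputable def LinearizationBasis.ofIso {X Y : QuiverOver Q} (e : X ≅ Y) {V : QRep K Q}
    (b : LinearizationBasis X V) : LinearizationBasis Y V := by
  classical
  have hV : ∀ x, QuiverOver.onV e.hom (QuiverOver.onV e.inv x) = x := fun x =>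
    congrArg (fun f : Y ⟶ Y => QuiverOver.onV f x) e.inv_hom_id
  have hV' : ∀ x, QuiverOver.onV e.inv (QuiverOver.onV e.hom x) = x := fun x =>
    congrArg (fun f : X ⟶ X => QuiverOver.onV f x) e.hom_inv_id
  have hA : ∀ x, QuiverOver.onA e.hom (QuiverOver.onA e.inv x) = x := fun x =>
    congrArg (fun f : Y ⟶ Y => QuiverOver.onA f x) e.inv_hom_id
  have hA' : ∀ x, QuiverOver.onA e.inv (QuiverOver.onA e.hom x) = x := fun x =>
    congrArg (fun f : X ⟶ X => QuiverOver.onA f x) e.hom_inv_id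
  let eV : ∀ x, X.str.FiberV x ≃ Y.str.FiberV x := fun x =>
    { toFun := fun y => ⟨QuiverOver.onV e.hom y.1, (QuiverOver.str_onV _ _).trans y.2⟩
      invFun := fun y => ⟨QuiverOver.onV e.inv y.1, (QuiverOver.str_onV _ _).trans y.2⟩
      left_inv := fun y => Subtype.ext (hV' y.1)
      right_inv := fun y => Subtype.ext (hV y.1) }
  let eA : ∀ x, X.str.FiberA x ≃ Y.str.FiberA x := fun x =>
    { toFun := fun y => ⟨QuiverOver.onA e.hom y.1, (QuiverOver.str_onA _ _).trans y.2⟩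
      invFun := fun y => ⟨QuiverOver.onA e.inv y.1, (QuiverOver.str_onA _ _).trans y.2⟩
      left_inv := fun y => Subtype.ext (hA' y.1)
      right_inv := fun y => Subtype.ext (hA y.1) }
  refine ⟨fun x => (b.basis x).reindex (eV x), fun α y => ?_⟩
  obtain ⟨y, rfl⟩ := (eV _).surjective y
  rw [Module.Basis.reindex_apply, Equiv.symm_apply_apply, b.map_basis]
  refine Fintype.sum_equiv (eA α) _ _ fun β => ?_
  have hs : Y.str.fiberS (eA α β) = eV _ (X.str.fiberS β) :=
    Subtype.ext (QuiverOver.s_onA e.hom β.1)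
  have ht : Y.str.fiberT (eA α β) = eV _ (X.str.fiberT β) :=
    Subtype.ext (QuiverOver.t_onA e.hom β.1)
  rw [hs, ht, Module.Basis.reindex_apply, Equiv.symm_apply_apply]
  simp only [(eV _).injective.eq_iff]

/-- The tensor product of bases is modelled on the fiber product. -/
noncomputable def LinearizationBasis.tensor {X Y : QuiverOver Q} {V W : QRep K Q}
    (b : LinearizationBasis X V) (c : LinearizationBasis Y W) :
    LinearizationBasis (fiberProduct X Y) (V.tensor W) := by
  classical
  let eV : ∀ x, X.str.FiberV x × Y.str.FiberV x ≃ (fiberProduct X Y).str.FiberV x := fun x =>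
    { toFun := fun p => ⟨⟨(p.1.1, p.2.1), p.1.2.trans p.2.2.symm⟩, p.1.2⟩
      invFun := fun p => (⟨p.1.1.1, p.2⟩, ⟨p.1.1.2, p.1.2.symm.trans p.2⟩)
      left_inv := fun _ => rfl
      right_inv := fun _ => rfl }
  let eA : ∀ x, X.str.FiberA x × Y.str.FiberA x ≃ (fiberProduct X Y).str.FiberA x := fun x =>
    { toFun := fun p => ⟨⟨(p.1.1, p.2.1), p.1.2.trans p.2.2.symm⟩, p.1.2⟩
      invFun := fun p => (⟨p.1.1.1, p.2⟩, ⟨p.1.1.2, p.1.2.symm.trans p.2⟩)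
      left_inv := fun _ => rfl
      right_inv := fun _ => rfl }
  refine ⟨fun x => ((b.basis x).tensorProduct (c.basis x)).reindex (eV x), fun α y => ?_⟩
  obtain ⟨y, rfl⟩ := (eV _).surjective y
  rw [Module.Basis.reindex_apply, Equiv.symm_apply_apply, Module.Basis.tensorProduct_apply',
    TensorProduct.map_tmul, b.map_basis, c.map_basis, TensorProduct.sum_tmul]
  simp only [TensorProduct.tmul_sum]
  -- Pairs of arrows over `α` are exactly the arrows of the fiber product over `α`.
  rw [← Fintype.sum_prod_type']
  refine Fintype.sum_equiv (eA α) _ _ fun β => ?_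
  have hs : (fiberProduct X Y).str.fiberS (eA α β) =
    eV _ (X.str.fiberS β.1, Y.str.fiberS β.2) := rfl
  have ht : (fiberProduct X Y).str.fiberT (eA α β) =
    eV _ (X.str.fiberT β.1, Y.str.fiberT β.2) := rfl
  rw [hs, ht, Module.Basis.reindex_apply, Equiv.symm_apply_apply,
    Module.Basis.tensorProduct_apply']
  simp only [(eV _).injective.eq_iff, Prod.ext_iff]
  -- A pair of arrows starts at a pair of vertices iff both components do; in every other case one
  -- tensor factor is zero.
  by_cases h₁ : X.str.fiberS β.1 = y.1 <;> by_cases h₂ : Y.str.fiberS β.2 = y.2 <;>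
    simp [h₁, h₂]

/-- A subtype of a disjoint union indexed by `Fin (n + 1)` splits off its first component. -/
noncomputable def sigmaFinSuccSubtypeEquiv {n : ℕ} (T : Fin (n + 1) → Type u)
    (P : (Σ i, T i) → Prop) :
    {y : T 0 // P ⟨0, y⟩} ⊕ {p : Σ i : Fin n, T i.succ // P ⟨p.1.succ, p.2⟩} ≃ {p // P p} :=
  Equiv.ofBijective
    (Sum.elim (fun y => ⟨⟨0, y.1⟩, y.2⟩) (fun y => ⟨⟨Fin.succ y.1.1, y.1.2⟩, y.2⟩)) (by
      constructor
      · rintro (⟨y, hy⟩ | ⟨⟨i, y⟩, hy⟩) (⟨z, hz⟩ | ⟨⟨j, z⟩, hz⟩) h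
        · obtain rfl : y = z := eq_of_heq (Sigma.mk.inj (congrArg Subtype.val h)).2
          rfl
        · exact absurd (congrArg (fun p => p.1.1) h) (Fin.succ_ne_zero j).symm
        · exact absurd (congrArg (fun p => p.1.1) h) (Fin.succ_ne_zero i)
        · obtain rfl : i = j := Fin.succ_injective _ (congrArg (fun p => p.1.1) h)
          obtain rfl : y = z := eq_of_heq (Sigma.mk.inj (congrArg Subtype.val h)).2
          rfl
      · rintro ⟨⟨i, y⟩, hy⟩
        cases i using Fin.cases with
        | zero => exact ⟨Sum.inl ⟨y, hy⟩, rfl⟩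
        | succ i => exact ⟨Sum.inr ⟨⟨i, y⟩, hy⟩, rfl⟩)

/-- The direct sum of bases is modelled on the disjoint union. -/
noncomputable def LinearizationBasis.directSum {n : ℕ} {X : Fin (n + 1) → QuiverOver Q}
    {V W : QRep K Q} (b : LinearizationBasis (X 0) V)
    (c : LinearizationBasis (disjointUnion fun i => X (Fin.succ i)) W) :
    LinearizationBasis (disjointUnion X) (V.directSum W) := by
  classical
  let eV : ∀ x, (X 0).str.FiberV x ⊕ (disjointUnion fun i => X (Fin.succ i)).str.FiberV x ≃
      (disjointUnion X).str.FiberV x := fun x =>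
    sigmaFinSuccSubtypeEquiv (fun i => (X i).dom.V) (fun p => (disjointUnion X).str.onV p = x)
  let eA : ∀ x, (X 0).str.FiberA x ⊕ (disjointUnion fun i => X (Fin.succ i)).str.FiberA x ≃
      (disjointUnion X).str.FiberA x := fun x =>
    sigmaFinSuccSubtypeEquiv (fun i => (X i).dom.A) (fun p => (disjointUnion X).str.onA p = x)
  refine ⟨fun x => ((b.basis x).prod (c.basis x)).reindex (eV x), fun α y => ?_⟩
  obtain ⟨y, rfl⟩ := (eV _).surjective y
  rw [Module.Basis.reindex_apply, Equiv.symm_apply_apply, ← (eA α).sum_comp,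
    Fintype.sum_sum_type]
  have hs : ∀ β, (disjointUnion X).str.fiberS (eA α (Sum.inl β)) =
    eV _ (Sum.inl ((X 0).str.fiberS β)) := fun _ => rfl
  have ht : ∀ β, (disjointUnion X).str.fiberT (eA α (Sum.inl β)) =
    eV _ (Sum.inl ((X 0).str.fiberT β)) := fun _ => rfl
  have hs' : ∀ β, (disjointUnion X).str.fiberS (eA α (Sum.inr β)) =
    eV _ (Sum.inr (FinQuiver.Hom.fiberS _ β)) := fun _ => rfl
  have ht' : ∀ β, (disjointUnion X).str.fiberT (eA α (Sum.inr β)) =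
    eV _ (Sum.inr (FinQuiver.Hom.fiberT _ β)) := fun _ => rfl
  simp only [hs, ht, hs', ht', Module.Basis.reindex_apply, Equiv.symm_apply_apply,
    (eV _).injective.eq_iff]
  rcases y with y | y
  · refine Prod.ext ?_ ?_
    · simp [b.map_basis, Prod.fst_sum, apply_ite Prod.fst]
    · simp [Prod.snd_sum, apply_ite Prod.snd]
  · refine Prod.ext ?_ ?_
    · simp [Prod.fst_sum, apply_ite Prod.fst]
    · simp [c.map_basis, Prod.snd_sum, apply_ite Prod.snd]

/-- The identity representation has a basis modelled on `Q` itself. -/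
noncomputable def LinearizationBasis.one :
    LinearizationBasis (Over.mk (𝟙 Q)) (QRep.one K Q) := by
  classical
  have hu : ∀ x, Unique ((QuiverOver.str (Over.mk (𝟙 Q))).FiberV x) := fun x =>
    ⟨⟨⟨x, rfl⟩⟩, fun y => Subtype.ext y.2⟩
  have hu' : ∀ x, Unique ((QuiverOver.str (Over.mk (𝟙 Q))).FiberA x) := fun x =>
    ⟨⟨⟨x, rfl⟩⟩, fun y => Subtype.ext y.2⟩
  refine ⟨fun x => Module.Basis.singleton _ K, fun α y => ?_⟩
  rw [Fintype.sum_unique, if_pos (Subsingleton.elim _ _)]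
  simp

end Linearization

/-! ### Linearizations in the representation ring. -/

section RepresentationRing

variable {K : Type u} [Field K] {Q : FinQuiver.{u}}

theorem RepRing.of_eq_of_iso {V W : QRep K Q} (e : V.Iso W) : RepRing.of V = RepRing.of W :=
  congrArg (fun c => Ideal.Quotient.mk (relIdeal K Q) (FreeAbelianGroup.of c))
    (Quotient.sound ⟨e⟩)

theorem RepRing.of_tensor (V W : QRep K Q) :
    RepRing.of (V.tensor W) = RepRing.of V * RepRing.of W := by
  rw [RepRing.of, RepRing.of, RepRing.of, ← map_mul, ← FreeAbelianGroup.of_mul]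
  rfl

theorem RepRing.of_one : RepRing.of (QRep.one K Q) = 1 := rfl

theorem RepRing.of_directSum (V W : QRep K Q) :
    RepRing.of (V.directSum W) = RepRing.of V + RepRing.of W := by
  rw [← sub_eq_zero, ← sub_sub]
  exact Ideal.Quotient.eq_zero_iff_mem.2 (AddSubgroup.subset_closure ⟨V, W, rfl⟩)

/-- Here `V ⊕ V ≅ V`, so `[V] + [V] = [V]`. This covers the empty disjoint union. -/
theorem RepRing.of_eq_zero {V : QRep K Q} (hV : V.IsZero) : RepRing.of V = 0 := by
  have e : (V.directSum V).Iso V :=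
    { equiv := fun x =>
        have := hV x
        { toFun := Prod.fst
          invFun := fun v => (v, v)
          map_add' := fun _ _ => rfl
          map_smul' := fun _ _ => rfl
          left_inv := fun _ => Prod.ext rfl (Subsingleton.elim _ _)
          right_inv := fun _ => rfl }
      comm := fun _ _ => rfl }
  have h := RepRing.of_eq_of_iso e
  rwa [RepRing.of_directSum, add_eq_left] at h

/-- The standard basis of `L(X ×_Q Y)` and the tensor products of standard basis vectors of `L(X)`
and `L(Y)` are modelled on the same quiver over `Q`. -/
theorem RepRing.of_linearization_fiberProduct (X Y : QuiverOver Q) :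
    RepRing.of (QRep.linearization K (fiberProduct X Y)) =
      RepRing.of (QRep.linearization K X) * RepRing.of (QRep.linearization K Y) := by
  rw [← RepRing.of_tensor]
  exact RepRing.of_eq_of_iso ((LinearizationBasis.standard K _).iso
    ((LinearizationBasis.standard K X).tensor (LinearizationBasis.standard K Y)))

theorem RepRing.of_linearization_congr {X Y : QuiverOver Q} (e : X ≅ Y) :
    RepRing.of (QRep.linearization K X) = RepRing.of (QRep.linearization K Y) :=
  RepRing.of_eq_of_iso
    (((LinearizationBasis.standard K X).ofIso e).iso (LinearizationBasis.standard K Y))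

theorem RepRing.of_linearization_disjointUnion {n : ℕ} (X : Fin n → QuiverOver Q) :
    RepRing.of (QRep.linearization K (disjointUnion X)) =
      ∑ i, RepRing.of (QRep.linearization K (X i)) := by
  induction n with
  | zero =>
    rw [Fin.sum_univ_zero]
    refine RepRing.of_eq_zero fun x => ?_
    have : IsEmpty ((disjointUnion X).str.FiberV x) := ⟨fun y => y.1.1.elim0⟩
    exact inferInstanceAs (Subsingleton ((disjointUnion X).str.FiberV x → K))
  | succ n ih =>
    rw [Fin.sum_univ_succ, ← ih, ← RepRing.of_directSum]
    exact RepRing.of_eq_of_iso ((LinearizationBasis.standard K _).iso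
      (LinearizationBasis.directSum (LinearizationBasis.standard K (X 0))
        (LinearizationBasis.standard K _)))

theorem RepRing.of_linearization_id :
    RepRing.of (QRep.linearization K (Over.mk (𝟙 Q) : QuiverOver Q)) = 1 :=
  (RepRing.of_eq_of_iso ((LinearizationBasis.standard K _).iso LinearizationBasis.one)).trans
    RepRing.of_one

end RepresentationRing

end QuiverRep

namespace QuiverRep

/-! ### Fitting's lemma and multiplicities of indecomposables. -/

namespace QRep

variable {K : Type u} [Field K] {Q : FinQuiver.{u}}

/-- The subrepresentation on a family of subspaces that is stable under the maps. -/
abbrev sub (V : QRep K Q) (S : ∀ x, Submodule K (V.space x))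
    (hS : ∀ α, ∀ v ∈ S (Q.s α), V.map α v ∈ S (Q.t α)) : QRep K Q where
  space x := S x
  map α := (V.map α).restrict (hS α)

/-- A representation is the direct sum of complementary subrepresentations. -/
noncomputable def isoOfIsCompl (V : QRep K Q) (S T : ∀ x, Submodule K (V.space x))
    (hS : ∀ α, ∀ v ∈ S (Q.s α), V.map α v ∈ S (Q.t α))
    (hT : ∀ α, ∀ v ∈ T (Q.s α), V.map α v ∈ T (Q.t α)) (h : ∀ x, IsCompl (S x) (T x)) :
    ((V.sub S hS).directSum (V.sub T hT)).Iso V where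
  equiv x := Submodule.prodEquivOfIsCompl (S x) (T x) (h x)
  comm α v := by simp

/-- The internal form of indecomposability, applied below to kernels and images. -/
theorem IsIndecomposable.eq_bot_or_eq_bot {V : QRep K Q} (hV : V.IsIndecomposable)
    (S T : ∀ x, Submodule K (V.space x))
    (hS : ∀ α, ∀ v ∈ S (Q.s α), V.map α v ∈ S (Q.t α))
    (hT : ∀ α, ∀ v ∈ T (Q.s α), V.map α v ∈ T (Q.t α)) (h : ∀ x, IsCompl (S x) (T x)) :
    (∀ x, S x = ⊥) ∨ ∀ x, T x = ⊥ :=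
  (hV.2 _ _ ⟨(V.isoOfIsCompl S T hS hT h).symm⟩).imp
    (fun h x => Submodule.subsingleton_iff_eq_bot.1 (h x))
    (fun h x => Submodule.subsingleton_iff_eq_bot.1 (h x))

/-- The space of homomorphisms of representations. -/
def homSpace (V W : QRep K Q) : Submodule K (∀ x, V.space x →ₗ[K] W.space x) where
  carrier := {f | ∀ α v, f (Q.t α) (V.map α v) = W.map α (f (Q.s α) v)}
  add_mem' hf hg α v := by simp [hf α v, hg α v]
  zero_mem' α v := by simp
  smul_mem' c f hf α v := by simp [hf α v]

/-- Composition of homomorphisms of representations. -/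
abbrev compHom {U V W : QRep K Q} (g : ∀ x, V.space x →ₗ[K] W.space x)
    (f : ∀ x, U.space x →ₗ[K] V.space x) : ∀ x, U.space x →ₗ[K] W.space x :=
  fun x => g x ∘ₗ f x

theorem compHom_mem {U V W : QRep K Q} {g : ∀ x, V.space x →ₗ[K] W.space x}
    {f : ∀ x, U.space x →ₗ[K] V.space x} (hg : g ∈ homSpace V W) (hf : f ∈ homSpace U V) :
    compHom g f ∈ homSpace U W := fun α v => by
  rw [LinearMap.comp_apply, hf, hg, LinearMap.comp_apply]

/-- The algebra of families of linear endomorphisms of the spaces of a representation. -/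
abbrev EndFamily (V : QRep K Q) : Type u := ∀ x, Module.End K (V.space x)

theorem one_mem_homSpace (V : QRep K Q) : (1 : V.EndFamily) ∈ homSpace V V := fun _ _ => rfl

theorem mul_mem_homSpace {V : QRep K Q} {a b : V.EndFamily} (ha : a ∈ homSpace V V)
    (hb : b ∈ homSpace V V) : a * b ∈ homSpace V V := compHom_mem ha hb

theorem pow_mem_homSpace {V : QRep K Q} {a : V.EndFamily} (ha : a ∈ homSpace V V) (n : ℕ) :
    a ^ n ∈ homSpace V V := by
  induction n with
  | zero => exact one_mem_homSpace V
  | succ n ih => exact pow_succ a n ▸ mul_mem_homSpace ih ha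

/-- Units and nilpotents are taken in the product of the rings `End(V_x)`; this lemma brings
inverses back to endomorphisms of the representation. -/
theorem inv_mem_homSpace {V : QRep K Q} (u : (V.EndFamily)ˣ)
    (hu : (u : V.EndFamily) ∈ homSpace V V) :
    ((u⁻¹ : (V.EndFamily)ˣ) : V.EndFamily) ∈ homSpace V V := by
  intro α v
  have h₁ : ∀ x w, ((u⁻¹ : (V.EndFamily)ˣ) : V.EndFamily) x ((u : V.EndFamily) x w) = w :=
    fun x w => LinearMap.congr_fun (congrFun u.inv_mul x) w
  have h₂ : ∀ x w, (u : V.EndFamily) x (((u⁻¹ : (V.EndFamily)ˣ) : V.EndFamily) x w) = w :=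
    fun x w => LinearMap.congr_fun (congrFun u.mul_inv x) w
  conv_lhs => rw [← h₂ _ v, ← hu, h₁]

theorem IsIndecomposable.nontrivial {V : QRep K Q} (hV : V.IsIndecomposable) :
    Nontrivial V.EndFamily := by
  by_contra h
  rw [not_nontrivial_iff_subsingleton] at h
  refine hV.1 fun x => ⟨fun v w => ?_⟩
  have h₁ : (1 : V.EndFamily) = 0 := Subsingleton.elim _ _
  have h₂ : ∀ v : V.space x, v = 0 := fun v => LinearMap.congr_fun (congrFun h₁ x) v
  rw [h₂ v, h₂ w]

/-- Fitting's lemma. -/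
theorem IsIndecomposable.isNilpotent_or_isUnit {V : QRep K Q} (hV : V.IsIndecomposable)
    {a : V.EndFamily} (ha : a ∈ homSpace V V) : IsNilpotent a ∨ IsUnit a := by
  -- One exponent serves all vertices because there are finitely many; `1 ≤ n` is needed to pass
  -- from `a x ^ n` being a unit to `a x` being one.
  obtain ⟨n, hn, h1⟩ : ∃ n, (∀ x, IsCompl (LinearMap.ker (a x ^ n)) (LinearMap.range (a x ^ n))) ∧
      1 ≤ n :=
    ((Filter.eventually_all.2 fun x =>
      LinearMap.eventually_isCompl_ker_pow_range_pow (a x)).and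
        (Filter.eventually_ge_atTop 1)).exists
  have hpow : ∀ α v, (a (Q.t α) ^ n) (V.map α v) = V.map α ((a (Q.s α) ^ n) v) :=
    pow_mem_homSpace ha n
  rcases hV.eq_bot_or_eq_bot (fun x => LinearMap.ker (a x ^ n))
    (fun x => LinearMap.range (a x ^ n))
    (fun α v hv => by rw [LinearMap.mem_ker] at hv ⊢; rw [hpow, hv, map_zero])
    (by rintro α _ ⟨v, rfl⟩; exact ⟨_, hpow α v⟩) hn with h | h
  · right
    rw [Pi.isUnit_iff]
    intro x
    have hu : IsUnit (a x ^ n) := (LinearMap.isUnit_iff_ker_eq_bot _).2 (h x)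
    exact (isUnit_pow_iff (by omega)).1 hu
  · left
    refine ⟨n, funext fun x => ?_⟩
    exact LinearMap.range_eq_bot.1 (h x)

theorem IsIndecomposable.not_isUnit_of_isNilpotent {V : QRep K Q} (hV : V.IsIndecomposable)
    {a : V.EndFamily} (ha : IsNilpotent a) : ¬ IsUnit a := by
  have := hV.nontrivial
  intro h
  obtain ⟨n, hn⟩ := ha
  exact not_isUnit_zero (hn ▸ h.pow n)

/-- The endomorphism ring of an indecomposable representation is local. -/
theorem IsIndecomposable.isNilpotent_add {V : QRep K Q} (hV : V.IsIndecomposable)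
    {a b : V.EndFamily} (ha : a ∈ homSpace V V) (hb : b ∈ homSpace V V)
    (hna : IsNilpotent a) (hnb : IsNilpotent b) : IsNilpotent (a + b) := by
  refine (hV.isNilpotent_or_isUnit (add_mem ha hb)).resolve_right ?_
  rintro ⟨u, hu⟩
  have hinv := inv_mem_homSpace u (hu ▸ add_mem ha hb)
  -- With `u = a + b` invertible, `u⁻¹a + u⁻¹b = 1`: if `u⁻¹a` is nilpotent, then `u⁻¹b`, hence `b`,
  -- is a unit; otherwise `a` is a unit.
  rcases hV.isNilpotent_or_isUnit (mul_mem_homSpace hinv ha) with h | h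
  · have h' := h.isUnit_one_sub
    have : 1 - (↑u⁻¹ : V.EndFamily) * a = ↑u⁻¹ * b := by
      rw [← u.inv_mul, hu, ← mul_sub, add_sub_cancel_left]
    rw [this, Units.isUnit_units_mul] at h'
    exact hV.not_isUnit_of_isNilpotent hnb h'
  · rw [Units.isUnit_units_mul] at h
    exact hV.not_isUnit_of_isNilpotent hna h

/-- The homomorphisms from an indecomposable representation `X` all of whose composites with
homomorphisms to `X` are nilpotent. -/
def radSpace {X : QRep K Q} (hX : X.IsIndecomposable) (M : QRep K Q) :
    Submodule K (∀ x, X.space x →ₗ[K] M.space x) where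
  carrier := {f | f ∈ homSpace X M ∧
    ∀ g ∈ homSpace M X, IsNilpotent (compHom g f : X.EndFamily)}
  add_mem' := fun ⟨hf, hf'⟩ ⟨hg, hg'⟩ => ⟨add_mem hf hg, fun k hk => by
    convert hX.isNilpotent_add (compHom_mem hk hf) (compHom_mem hk hg) (hf' k hk) (hg' k hk)
    exact funext fun x => LinearMap.ext fun v => map_add (k x) _ _⟩
  zero_mem' := ⟨zero_mem _, fun k _ => by
    have h : (compHom k 0 : X.EndFamily) = 0 :=
      funext fun x => LinearMap.ext fun v => map_zero (k x)
    rw [h]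
    exact IsNilpotent.zero⟩
  smul_mem' := fun c f ⟨hf, hf'⟩ => ⟨Submodule.smul_mem _ c hf, fun k hk => by
    have h : (compHom k (c • f) : X.EndFamily) = c • (compHom k f : X.EndFamily) :=
      funext fun x => LinearMap.ext fun v => map_smul (k x) c _
    rw [h]
    exact (hf' k hk).smul c⟩

theorem radSpace_le {X : QRep K Q} (hX : X.IsIndecomposable) (M : QRep K Q) :
    radSpace hX M ≤ homSpace X M := fun _ h => h.1

/-- The multiplicity (up to a positive factor) of an indecomposable representation. -/
noncomputable def multiplicity {X : QRep K Q} (hX : X.IsIndecomposable) (M : QRep K Q) : ℤ :=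
  Module.finrank K (homSpace X M) - Module.finrank K (radSpace hX M)

/-- The identity of `X` is a homomorphism outside the radical, so the inclusion is strict. -/
theorem multiplicity_self {X : QRep K Q} (hX : X.IsIndecomposable) :
    multiplicity hX X ≠ 0 := by
  have hlt : radSpace hX X < homSpace X X := by
    refine lt_of_le_of_ne (radSpace_le hX X) fun h => ?_
    have h₁ : (1 : X.EndFamily) ∈ radSpace hX X := h ▸ one_mem_homSpace X
    exact hX.not_isUnit_of_isNilpotent (h₁.2 1 (one_mem_homSpace X)) isUnit_one
  have := Submodule.finrank_lt_finrank_of_lt hlt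
  rw [multiplicity]
  omega

/-- If some endomorphism of `X` factoring through an indecomposable `Y` is invertible, then `X`
and `Y` are isomorphic. -/
theorem nonempty_iso_of_isUnit_compHom {X Y : QRep K Q} (hX : X.IsIndecomposable)
    (hY : Y.IsIndecomposable) {f : ∀ x, X.space x →ₗ[K] Y.space x}
    {g : ∀ x, Y.space x →ₗ[K] X.space x} (hf : f ∈ homSpace X Y) (hg : g ∈ homSpace Y X)
    (hu : IsUnit (compHom g f : X.EndFamily)) : Nonempty (X.Iso Y) := by
  have hbij : ∀ x, Function.Bijective (g x ∘ₗ f x) := fun x =>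
    (Module.End.isUnit_iff _).1 (Pi.isUnit_iff.1 hu x)
  have hinj : ∀ x, Function.Injective (f x) := fun x =>
    Function.Injective.of_comp (f := g x) (hbij x).1
  -- As `g f` is bijective, `Y = im f ⊕ ker g`. If `im f = 0`, injectivity of `f` makes `X` zero; if
  -- `ker g = 0`, then `f` is also onto.
  rcases hY.eq_bot_or_eq_bot (fun x => LinearMap.range (f x)) (fun x => LinearMap.ker (g x))
    (by rintro α _ ⟨v, rfl⟩; exact ⟨_, hf α v⟩)
    (fun α v hv => by rw [LinearMap.mem_ker] at hv ⊢; rw [hg, hv, map_zero])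
    (fun x => by
      constructor
      · rw [Submodule.disjoint_def]
        rintro _ ⟨v, rfl⟩ hv
        have : v = 0 := (hbij x).1 (by rw [map_zero]; exact hv)
        rw [this, map_zero]
      · rw [codisjoint_iff, eq_top_iff]
        intro v _
        obtain ⟨w, hw⟩ := (hbij x).2 (g x v)
        refine Submodule.mem_sup.2 ⟨f x w, ⟨w, rfl⟩, v - f x w, ?_, add_sub_cancel _ _⟩
        rw [LinearMap.mem_ker, map_sub, sub_eq_zero]
        exact hw.symm) with h | h
  · refine absurd (fun x => ⟨fun v w => hinj x ?_⟩) hX.1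
    rw [LinearMap.range_eq_bot.1 (h x)]
    rfl
  · have hgi : ∀ x, Function.Injective (g x) := fun x => LinearMap.ker_eq_bot.1 (h x)
    have hsurj : ∀ x, Function.Surjective (f x) := fun x v => by
      obtain ⟨w, hw⟩ := (hbij x).2 (g x v)
      exact ⟨w, hgi x hw⟩
    exact ⟨⟨fun x => LinearEquiv.ofBijective (f x) ⟨hinj x, hsurj x⟩, hf⟩⟩

/-- By Fitting's lemma an endomorphism of `X` through `Y` is nilpotent or invertible, and the latter
would give an isomorphism. So every homomorphism is radical. -/
theorem multiplicity_eq_zero {X Y : QRep K Q} (hX : X.IsIndecomposable)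
    (hY : Y.IsIndecomposable) (h : IsEmpty (X.Iso Y)) : multiplicity hX Y = 0 := by
  have : radSpace hX Y = homSpace X Y := by
    refine le_antisymm (radSpace_le hX Y) fun f hf => ⟨hf, fun g hg => ?_⟩
    refine (hX.isNilpotent_or_isUnit (compHom_mem hg hf)).resolve_right fun hu => ?_
    obtain ⟨e⟩ := nonempty_iso_of_isUnit_compHom hX hY hf hg hu
    exact h.false e
  rw [multiplicity, this, sub_self]

theorem finrank_eq_of_mem_iff {V W : Type*} [AddCommGroup V] [Module K V] [AddCommGroup W]
    [Module K W] (E : V ≃ₗ[K] W) {S : Submodule K V} {T : Submodule K W}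
    (h : ∀ v, E v ∈ T ↔ v ∈ S) : Module.finrank K T = Module.finrank K S := by
  have hS : S = T.comap (E : V →ₗ[K] W) := Submodule.ext fun v => (h v).symm
  rw [hS]
  exact (E.ofSubmodule' T).finrank_eq.symm

theorem finrank_submodule_prod {V W : Type*} [AddCommGroup V] [Module K V] [AddCommGroup W]
    [Module K W] [FiniteDimensional K V] [FiniteDimensional K W] (S : Submodule K V)
    (T : Submodule K W) :
    Module.finrank K (S.prod T) = Module.finrank K S + Module.finrank K T := by
  let e : S.prod T ≃ₗ[K] S × T :=
    { toFun := fun p => (⟨p.1.1, p.2.1⟩, ⟨p.1.2, p.2.2⟩)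
      invFun := fun p => ⟨(p.1.1, p.2.1), ⟨p.1.2, p.2.2⟩⟩
      map_add' := fun _ _ => rfl
      map_smul' := fun _ _ => rfl
      left_inv := fun _ => rfl
      right_inv := fun _ => rfl }
  rw [e.finrank_eq, Module.finrank_prod]

theorem Iso.mem_homSpace {V W : QRep K Q} (e : V.Iso W) :
    (fun x => (e.equiv x : V.space x →ₗ[K] W.space x)) ∈ homSpace V W := e.comm

theorem multiplicity_congr {X : QRep K Q} (hX : X.IsIndecomposable) {M N : QRep K Q}
    (e : M.Iso N) : multiplicity hX M = multiplicity hX N := by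
  let E : (∀ x, X.space x →ₗ[K] M.space x) ≃ₗ[K] (∀ x, X.space x →ₗ[K] N.space x) :=
    LinearEquiv.piCongrRight fun x => LinearEquiv.congrRight (e.equiv x)
  have hE : ∀ f x v, E f x v = e.equiv x (f x v) := fun _ _ _ => rfl
  have hhom : ∀ f, E f ∈ homSpace X N ↔ f ∈ homSpace X M := fun f => by
    refine forall₂_congr fun α v => ?_
    rw [hE, hE, ← e.comm, (e.equiv _).injective.eq_iff]
  have hrad : ∀ f, E f ∈ radSpace hX N ↔ f ∈ radSpace hX M := fun f => by
    refine and_congr (hhom f) ⟨fun h g hg => ?_, fun h g hg => ?_⟩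
    · convert h _ (compHom_mem hg e.symm.mem_homSpace) using 1
      refine funext fun x => LinearMap.ext fun v => ?_
      exact congrArg (g x) ((e.equiv x).symm_apply_apply (f x v)).symm
    · exact h _ (compHom_mem hg e.mem_homSpace)
  rw [multiplicity, multiplicity, finrank_eq_of_mem_iff E hhom, finrank_eq_of_mem_iff E hrad]

/-- Both `Hom(X, -)` and its radical part turn direct sums into products, so their dimensions add.
-/
theorem multiplicity_directSum {X : QRep K Q} (hX : X.IsIndecomposable) (M N : QRep K Q) :
    multiplicity hX (M.directSum N) = multiplicity hX M + multiplicity hX N := by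
  let E : ((∀ x, X.space x →ₗ[K] M.space x) × (∀ x, X.space x →ₗ[K] N.space x)) ≃ₗ[K]
      (∀ x, X.space x →ₗ[K] (M.directSum N).space x) :=
    { toFun := fun p x => (p.1 x).prod (p.2 x)
      invFun := fun f => (fun x => LinearMap.fst K _ _ ∘ₗ f x, fun x => LinearMap.snd K _ _ ∘ₗ f x)
      map_add' := fun _ _ => rfl
      map_smul' := fun _ _ => rfl
      left_inv := fun _ => rfl
      right_inv := fun _ => rfl }
  have hfst : (fun x => LinearMap.fst K (M.space x) (N.space x)) ∈ homSpace (M.directSum N) M :=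
    fun _ _ => rfl
  have hsnd : (fun x => LinearMap.snd K (M.space x) (N.space x)) ∈ homSpace (M.directSum N) N :=
    fun _ _ => rfl
  have hinl : (fun x => LinearMap.inl K (M.space x) (N.space x)) ∈ homSpace M (M.directSum N) :=
    fun α v => by simp
  have hinr : (fun x => LinearMap.inr K (M.space x) (N.space x)) ∈ homSpace N (M.directSum N) :=
    fun α v => by simp
  have hhom : ∀ p, E p ∈ homSpace X (M.directSum N) ↔
      p ∈ (homSpace X M).prod (homSpace X N) := fun p =>
    ⟨fun h => ⟨compHom_mem hfst h, compHom_mem hsnd h⟩,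
      fun h α v => Prod.ext (h.1 α v) (h.2 α v)⟩
  have hrad : ∀ p, E p ∈ radSpace hX (M.directSum N) ↔
      p ∈ (radSpace hX M).prod (radSpace hX N) := by
    refine fun p => ⟨fun h => ⟨⟨((hhom p).1 h.1).1, fun g hg => ?_⟩,
      ⟨((hhom p).1 h.1).2, fun g hg => ?_⟩⟩,
      fun h => ⟨(hhom p).2 ⟨h.1.1, h.2.1⟩, fun g hg => ?_⟩⟩
    · exact h.2 _ (compHom_mem hg hfst)
    · exact h.2 _ (compHom_mem hg hsnd)
    · have h₁ := compHom_mem hg hinl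
      have h₂ := compHom_mem hg hinr
      -- The composite through `M ⊕ N` is the sum of those through `M` and `N`; locality of the
      -- endomorphism ring keeps it nilpotent.
      convert hX.isNilpotent_add (compHom_mem h₁ h.1.1) (compHom_mem h₂ h.2.1)
        (h.1.2 _ h₁) (h.2.2 _ h₂) using 1
      refine funext fun x => LinearMap.ext fun v => ?_
      change g x (p.1 x v, p.2 x v) = g x (p.1 x v, 0) + g x (0, p.2 x v)
      rw [← map_add, Prod.mk_add_mk, add_zero, zero_add]
  rw [multiplicity, multiplicity, multiplicity, finrank_eq_of_mem_iff E hhom,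
    finrank_eq_of_mem_iff E hrad, finrank_submodule_prod, finrank_submodule_prod]
  push_cast
  ring

end QRep

/-! ### Independence of indecomposable classes. -/

section KrullSchmidt

variable {K : Type u} [Field K] {Q : FinQuiver.{u}}

/-- The additive extension of the multiplicity to the free abelian group on isomorphism
classes. -/
noncomputable def multiplicityHom {X : QRep K Q} (hX : X.IsIndecomposable) :
    FreeAbelianGroup (IsoClass K Q) →+ ℤ :=
  FreeAbelianGroup.lift (Quotient.lift (fun M => QRep.multiplicity hX M)
    fun _ _ ⟨e⟩ => QRep.multiplicity_congr hX e)

theorem multiplicityHom_of {X : QRep K Q} (hX : X.IsIndecomposable) (M : QRep K Q) :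
    multiplicityHom hX (FreeAbelianGroup.of (IsoClass.mk M)) = QRep.multiplicity hX M :=
  FreeAbelianGroup.lift_apply_of _ _

theorem multiplicityHom_eq_zero {X : QRep K Q} (hX : X.IsIndecomposable)
    {r : FreeAbelianGroup (IsoClass K Q)} (hr : r ∈ relIdeal K Q) : multiplicityHom hX r = 0 := by
  have hle : relSubgroup K Q ≤ (multiplicityHom hX).ker := by
    rw [relSubgroup, AddSubgroup.closure_le]
    rintro _ ⟨V, W, rfl⟩
    rw [SetLike.mem_coe, AddMonoidHom.mem_ker, map_sub, map_sub, multiplicityHom_of,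
      multiplicityHom_of, multiplicityHom_of, QRep.multiplicity_directSum]
    ring
  exact hle hr

/-- The classes of pairwise non-isomorphic indecomposable representations are linearly independent
in the representation ring. -/
theorem injective_linearCombination_of {ι : Type*} (V : ι → QRep K Q)
    (hV : ∀ i, (V i).IsIndecomposable) (hiso : ∀ i j, i ≠ j → IsEmpty ((V i).Iso (V j))) :
    Function.Injective (Finsupp.linearCombination ℤ fun i => RepRing.of (V i)) := by
  rw [injective_iff_map_eq_zero]
  intro a ha
  have hmem : (a.sum fun i n => n • FreeAbelianGroup.of (IsoClass.mk (V i))) ∈ relIdeal K Q := by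
    rw [← Ideal.Quotient.eq_zero_iff_mem, Finsupp.sum, map_sum, ← ha,
      Finsupp.linearCombination_apply, Finsupp.sum]
    exact Finset.sum_congr rfl fun i _ => map_zsmul _ _ _
  ext i
  -- The multiplicity of `V i` kills all other terms, leaving `a i` times a nonzero integer.
  have h := multiplicityHom_eq_zero (hV i) hmem
  rw [Finsupp.sum, map_sum, Finset.sum_eq_single i] at h
  · rw [map_zsmul, multiplicityHom_of, smul_eq_mul] at h
    exact (mul_eq_zero.1 h).resolve_right (QRep.multiplicity_self (hV i))
  · intro j _ hji
    rw [map_zsmul, multiplicityHom_of,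
      QRep.multiplicity_eq_zero (hV i) (hV j) (hiso i j hji.symm), smul_zero]
  · intro hi
    rw [Finsupp.notMem_support_iff.1 hi, zero_smul, map_zero]

end KrullSchmidt

end QuiverRep

namespace QuiverRep

/-! ### The product formula for objects and the main theorem. -/

section Main

variable (K : Type u) [Field K] {Q : FinQuiver.{u}} (C : ObjectProperty (QuiverOver Q))

theorem linearizationMap_single (X : C.FullSubcategory) :
    linearizationMap K C (Finsupp.single X 1) = RepRing.of (QRep.linearization K X.obj) := by
  rw [linearizationMap, Finsupp.linearCombination_single, one_smul]

/-- The decomposition of the fiber product of two objects into objects is compatible with the marks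
and the linearization. -/
theorem exists_product_of_closedUnderFiberProducts
    (hconn : ∀ X, C X → X.dom.IsConnected) (hfiber : ClosedUnderFiberProducts C)
    (X Y : C.FullSubcategory) : ∃ p : C.FullSubcategory →₀ ℤ,
      (∀ W : C.FullSubcategory, mark W p = (Nat.card (W ⟶ X) : ℤ) * Nat.card (W ⟶ Y)) ∧
      linearizationMap K C p =
        linearizationMap K C (Finsupp.single X 1) * linearizationMap K C (Finsupp.single Y 1) := by
  obtain ⟨n, Z, hZ, ⟨e⟩⟩ := hfiber X.obj Y.obj X.property Y.property
  refine ⟨∑ i, Finsupp.single (⟨Z i, hZ i⟩ : C.FullSubcategory) 1, fun W => ?_, ?_⟩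
  · simp only [map_sum, mark_single, one_mul, card_fullSubcategory_hom]
    rw [← Nat.cast_mul, ← card_hom_fiberProduct, card_hom_congr e,
      card_hom_disjointUnion (hconn _ W.property), Nat.cast_sum]
  · simp only [map_sum, linearizationMap_single]
    rw [← RepRing.of_linearization_fiberProduct, RepRing.of_linearization_congr e,
      RepRing.of_linearization_disjointUnion]

/-- The base quiver is a terminal object of every full subcategory containing it. -/
noncomputable def isTerminalBase (hC : C (Over.mk (𝟙 Q))) :
    Limits.IsTerminal (⟨Over.mk (𝟙 Q), hC⟩ : C.FullSubcategory) :=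
  Limits.IsTerminal.isTerminalOfObj C.ι _ Over.mkIdTerminal

end Main

end QuiverRep

open QuiverRep
theorem mainTheorem3 {K : Type u} [Field K] {Q : FinQuiver.{u}}
    (C : ObjectProperty (QuiverOver Q))
    [LowerFinite C.FullSubcategory]
    (hacyclic : IsAcyclicCategory C.FullSubcategory)
    (hconn : ∀ X, C X → X.dom.IsConnected)
    (hwrap : ∀ X, C X → X.str.IsWrapping)
    (hfiber : ClosedUnderFiberProducts C)
    (hindec : ∀ X, C X → (QRep.linearization K X).IsIndecomposable)
    (hiso : ∀ X Y, C X → C Y → X ≠ Y →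
      IsEmpty ((QRep.linearization K X).Iso (QRep.linearization K Y))) :
    (OrthogonalIdempotents
        (fun x : C.FullSubcategory => linearizationMap K C (delta x)) ∧
      ∃ b : Module.Basis C.FullSubcategory ℤ
          (NonUnitalSubring.closure
            (Set.range fun x : C.FullSubcategory => RepRing.of (QRep.linearization K x.obj))),
        ∀ x, (b x : RepRing K Q) = linearizationMap K C (delta x)) ∧
    (C (Over.mk (𝟙 Q)) →
      ∃ Φ : RepRing K Q ≃+*
          ((x : C.FullSubcategory) →
            (Ideal.span {linearizationMap K C (delta x)} : Ideal (RepRing K Q))),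
        ∀ r x, (Φ r x : RepRing K Q) = r * linearizationMap K C (delta x)) := by
  have hmul := exists_mark_eq_mul (linearizationMap K C)
    (exists_product_of_closedUnderFiberProducts K C hconn hfiber)
  have horth := delta_orthogonalIdempotents hacyclic (linearizationMap K C) hmul
  refine ⟨⟨horth, ?_⟩, fun hC => ?_⟩
  · have hinj : Function.Injective (linearizationMap K C) :=
      injective_linearCombination_of (fun X : C.FullSubcategory => QRep.linearization K X.obj)
        (fun X => hindec _ X.property) fun X Y hXY => hiso _ _ X.property Y.property fun h =>
          hXY (ObjectProperty.FullSubcategory.ext h)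
    rw [← funext (linearizationMap_single K C)]
    exact exists_basis_closure hacyclic (linearizationMap K C)
      (fun a b => (hmul a b).imp fun _ h => h.2) hinj
  · have ht := isTerminalBase C hC
    -- Every object lies below the terminal one, so lower finiteness makes the whole category finite
    -- and the product finite.
    have := finite_of_isTerminal ht
    have := Fintype.ofFinite C.FullSubcategory
    refine exists_ringEquiv_pi_span ⟨horth, ?_⟩
    -- Completeness: the `δ_x` add up to the object `(Q, id)`, whose linearization is the unit of
    -- `R(Q)`.
    rw [← map_sum, sum_delta_of_isTerminal hacyclic ht, linearizationMap_single,
      RepRing.of_linearization_id]
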